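/- Let $d\ge 1$, $1<p<1+\frac4d$, and let $V:\mathbb R^d\to[0,\infty)$ be locally bounded and Hölder continuous on bounded sets with some exponent $\alpha\in(0,1)$, with $\inf_{\mathbb R^d}V=0$ and $V(x)\to\infty$ as $|x|\to\infty$. Let $\mathcal H=\{u\in H^1(\mathbb R^d;\mathbb R):\int V|u|^2\,dx<\infty\}$. For $\rho>0$ and $\mu\in\mathbb R$ put $$E_\rho(u)=\tfrac12\int|\nabla u|^2\,dx+\tfrac12\int V|u|^2\,dx-\tfrac{\rho^{p-1}}{p+1}\int|u|^{p+1}\,dx,$$ $$F_{\mu,\rho}(u)=\tfrac12\int|\nabla u|^2\,dx+\tfrac12\int (V-\mu)|u|^2\,dx-\tfrac{\rho^{p-1}}{p+1}\int|u|^{p+1}\,dx.$$ Let $M_\rho$ be the set of minimizers of $e(\rho)=\inf\{E_\rho(u):u\in\mathcal H,\ \|u\|_2^2=1\}$, let $S_{\mu,\rho}=\{u\in\mathcal H\setminus\{0\}:\langle F_{\mu,\rho}'(u),\varphi\rangle=0\ \ \forall\varphi\in\mathcal H\}$, and let $G_{\mu,\rho}=\{u\in S_{\mu,\rho}:F_{\mu,\rho}(u)\le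 F_{\mu,\rho}(v)\ \ \forall v\in S_{\mu,\rho}\}$ be the set of ground states. Then for almost every $\rho\in(0,\infty)$ the set $M_\rho$ is nonempty and there is a number $\mu_\rho\in\mathbb R$ such that (i) every $u\in M_\rho$ is a weak solution (tested against all $\varphi\in\mathcal H$) of $$-\Delta u+Vu=\mu_\rho u+\rho^{p-1}|u|^{p-1}u\quad\text{in }\mathbb R^d;$$ (ii) $G_{\mu_\rho,\rho}=M_\rho$. -/

import Mathlib

open MeasureTheory Filter Topology Set
open scoped NNReal ENNReal ContDiff

noncomputable section

namespace NLS

/-- Euclidean space of dimension `d`. -/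
abbrev Rd (d : ℕ) : Type := EuclideanSpace ℝ (Fin d)

/-- Real-valued `L²` functions on Euclidean space (almost everywhere classes, Lebesgue measure). -/
abbrev L2 (d : ℕ) : Type := Lp ℝ 2 (volume : Measure (Rd d))

/-- `L²` vector fields on Euclidean space. -/
abbrev L2Vec (d : ℕ) : Type := Lp (Rd d) 2 (volume : Measure (Rd d))

/-- `g` is the weak (distributional) gradient of `u`: integration by parts holds against all
smooth compactly supported test functions. -/
def HasWeakGradient {d : ℕ} (u : L2 d) (g : L2Vec d) : Prop :=
  ∀ φ : Rd d → ℝ, ContDiff ℝ ∞ φ → HasCompactSupport φ →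
    ∫ x, u x • gradient φ x = - ∫ x, φ x • g x

/-- `u` belongs to the Sobolev space `H¹`: it is in `L²` with weak gradient in `L²`. -/
def MemH1 {d : ℕ} (u : L2 d) : Prop := ∃ g : L2Vec d, HasWeakGradient u g

open Classical in
/-- The weak gradient of an `H¹` function (and zero outside `H¹`, a value never used below). -/
def weakGradient {d : ℕ} (u : L2 d) : L2Vec d :=
  if h : MemH1 u then h.choose else 0

/-- Trapping potentials: locally bounded, (locally) Hölder continuous with some exponent
`α ∈ (0,1)`, with infimum zero, and tending to infinity at infinity. -/
structure IsTrap {d : ℕ} (V : Rd d → ℝ) : Prop where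
  locally_bounded : ∀ R : ℝ, ∃ C : ℝ, ∀ x ∈ Metric.closedBall (0 : Rd d) R, |V x| ≤ C
  holder : ∃ α : ℝ≥0, 0 < α ∧ α < 1 ∧
    ∀ R : ℝ, ∃ C : ℝ≥0, HolderOnWith C α V (Metric.closedBall (0 : Rd d) R)
  inf_eq_zero : IsGLB (range V) 0
  tendsto_infinity : Tendsto V (cocompact (Rd d)) atTop

/-- The energy space `{u ∈ H¹ : ∫ V |u|² < ∞}`. -/
def energySpace {d : ℕ} (V : Rd d → ℝ) : Set (L2 d) :=
  {u | MemH1 u ∧ Integrable (fun x => V x * |u x| ^ 2)}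

/-- The Gross-Pitaevskii energy
`½ ∫ |∇u|² + ½ ∫ V |u|² - ρ^(p-1)/(p+1) ∫ |u|^(p+1)`. -/
def energy {d : ℕ} (V : Rd d → ℝ) (p ρ : ℝ) (u : L2 d) : ℝ :=
  1 / 2 * (∫ x, ‖weakGradient u x‖ ^ 2) + 1 / 2 * (∫ x, V x * |u x| ^ 2)
    - ρ ^ (p - 1) / (p + 1) * ∫ x, |u x| ^ (p + 1)

/-- The action
`½ ∫ |∇u|² + ½ ∫ (V - μ) |u|² - ρ^(p-1)/(p+1) ∫ |u|^(p+1)`. -/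
def action {d : ℕ} (V : Rd d → ℝ) (p μ ρ : ℝ) (u : L2 d) : ℝ :=
  1 / 2 * (∫ x, ‖weakGradient u x‖ ^ 2) + 1 / 2 * (∫ x, (V x - μ) * |u x| ^ 2)
    - ρ ^ (p - 1) / (p + 1) * ∫ x, |u x| ^ (p + 1)

/-- The constraint set: functions of unit mass in the energy space. -/
def unitMass {d : ℕ} (V : Rd d → ℝ) : Set (L2 d) :=
  {u | u ∈ energySpace V ∧ ∫ x, |u x| ^ 2 = 1}

/-- The set `M_ρ` of constrained minimizers: the functions of unit mass at which the infimum
of the energy over all functions of unit mass is attained. -/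
def minimizers {d : ℕ} (V : Rd d → ℝ) (p ρ : ℝ) : Set (L2 d) :=
  {u | u ∈ unitMass V ∧ ∀ v ∈ unitMass V, energy V p ρ u ≤ energy V p ρ v}

/-- `u` solves `-Δu + V u = μ u + ρ^(p-1) |u|^(p-1) u` weakly in the energy space. -/
def IsWeakSolution {d : ℕ} (V : Rd d → ℝ) (p μ ρ : ℝ) (u : L2 d) : Prop :=
  u ∈ energySpace V ∧ ∀ φ ∈ energySpace V,
    (∫ x, inner ℝ (weakGradient u x) (weakGradient φ x)) + (∫ x, V x * u x * φ x)
      = μ * (∫ x, u x * φ x) + ρ ^ (p - 1) * ∫ x, |u x| ^ (p - 1) * u x * φ x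

/-- The set `S_{μ,ρ}` of nontrivial critical points of the action on the energy space:
the derivative of the action at `u` vanishes in every direction `φ` of the energy space. -/
def nontrivialSolutions {d : ℕ} (V : Rd d → ℝ) (p μ ρ : ℝ) : Set (L2 d) :=
  {u | u ∈ energySpace V ∧ u ≠ 0 ∧
    ∀ φ ∈ energySpace V, HasDerivAt (fun t : ℝ => action V p μ ρ (u + t • φ)) 0 0}

/-- The set `G_{μ,ρ}` of ground states: nontrivial solutions of least action among all
nontrivial solutions. -/
def groundStates {d : ℕ} (V : Rd d → ℝ) (p μ ρ : ℝ) : Set (L2 d) :=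
  {u | u ∈ nontrivialSolutions V p μ ρ ∧
    ∀ v ∈ nontrivialSolutions V p μ ρ, action V p μ ρ u ≤ action V p μ ρ v}

end NLS

end

/-!
For every `ρ > 0` the energy has a minimizer on the unit sphere of `L²`, and at such a minimizer the
Lagrange multiplier is determined by the minimal energy and by the number `∫ |u|^(p+1)`. Adding the
minimality inequalities for two masses shows that `∫ |u|^(p+1)` is monotone in `ρ` across
minimizers (`integral_rpow_le_of_lt`). A monotone function has countably many discontinuities, and
at a point of continuity all minimizers share the value of `∫ |u|^(p+1)`, hence the multiplier `μ`
(`ae_integral_rpow_eq`, `isWeakSolution_of_mem_minimizers`).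

Once all minimizers have the multiplier `μ`, they are the ground states
(`groundStates_eq_minimizers`). A nontrivial solution `v` satisfies the Nehari identity, so that
`t ↦ F(t v)` has a strict maximum at `t = 1` among `t > 0` (`action_smul_lt`). On the unit sphere
`F = E - μ / 2`. Taking `t = 1 / ‖v‖` gives `F(v) ≥ F(t v) ≥ min E - μ / 2`, with equality only if
`v` has unit mass and minimizes the energy.

Existence (`minimizers_nonempty`) is the direct method. All the analysis of `H¹` that it needs comes
from the translation estimate `‖u(· + y) - u‖ ≤ ‖y‖ ‖∇u‖`, proved by duality with test functions:
* averaging over small balls, it bounds the mass of `u` on a superlevel set `{|u| ≥ l}` by a multiple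
  of `l ^ (-4 / d) ‖∇u‖²` for bounded mass (`HasWeakGradient.lintegral_superlevel_le`), and summing
  over dyadic levels gives `∫ |u|^(p+1) ≤ C ‖u‖² + ε ‖∇u‖²` when `p < 1 + 4 / d`
  (`exists_lintegral_rpow_le`); this yields coercivity, and convergence in `L^(p+1)` of sequences
  that converge in `L²`;
* it gives strong local convergence in `L²` of weakly convergent sequences, since averages over
  balls of a weakly null sequence tend to zero pointwise
  (`tendsto_lintegral_ball_of_tendsto_inner`). The growth of `V` controls the mass far away, so that
  the convergence is global (`tendsto_of_tendsto_inner`).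
-/

namespace NLS

variable {d : ℕ}

/-! ### Weak gradients -/

theorem continuous_gradient_of_contDiff {φ : Rd d → ℝ} (hφ : ContDiff ℝ ∞ φ) :
    Continuous (gradient φ) := by
  have h : Continuous (fderiv ℝ φ) := hφ.continuous_fderiv (by simp)
  exact (InnerProductSpace.toDual ℝ (Rd d)).symm.continuous.comp h

theorem hasCompactSupport_gradient {φ : Rd d → ℝ} (hc : HasCompactSupport φ) :
    HasCompactSupport (gradient φ) :=
  (hc.fderiv (𝕜 := ℝ)).comp_left (g := (InnerProductSpace.toDual ℝ (Rd d)).symm) (map_zero _)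

theorem integrable_smul_gradient (u : L2 d) {φ : Rd d → ℝ} (hφ : ContDiff ℝ ∞ φ)
    (hc : HasCompactSupport φ) : Integrable (fun x => u x • gradient φ x) :=
  memLp_one_iff_integrable.1 <| MemLp.smul (p := 2) (q := 2)
    ((continuous_gradient_of_contDiff hφ).memLp_of_hasCompactSupport
      (hasCompactSupport_gradient hc)) (Lp.memLp u)

theorem integrable_test_smul (g : L2Vec d) {φ : Rd d → ℝ} (hφ : ContDiff ℝ ∞ φ)
    (hc : HasCompactSupport φ) : Integrable (fun x => φ x • g x) :=
  memLp_one_iff_integrable.1 <| MemLp.smul (p := 2) (q := 2) (Lp.memLp g)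
    (hφ.continuous.memLp_of_hasCompactSupport hc)

theorem HasWeakGradient.unique {u : L2 d} {g g' : L2Vec d} (h : HasWeakGradient u g)
    (h' : HasWeakGradient u g') : g = g' := by
  refine Lp.ext ?_
  refine ae_eq_of_integral_contDiff_smul_eq ((Lp.memLp g).locallyIntegrable (by norm_num))
    ((Lp.memLp g').locallyIntegrable (by norm_num)) fun φ hφ hc => ?_
  rw [← neg_inj, ← h φ hφ hc, ← h' φ hφ hc]

theorem MemH1.hasWeakGradient {u : L2 d} (h : MemH1 u) : HasWeakGradient u (weakGradient u) := by
  rw [weakGradient, dif_pos h]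
  exact h.choose_spec

theorem HasWeakGradient.weakGradient_eq {u : L2 d} {g : L2Vec d} (h : HasWeakGradient u g) :
    weakGradient u = g :=
  (MemH1.hasWeakGradient ⟨g, h⟩).unique h

theorem HasWeakGradient.add {u v : L2 d} {g k : L2Vec d} (hu : HasWeakGradient u g)
    (hv : HasWeakGradient v k) : HasWeakGradient (u + v) (g + k) := by
  intro φ hφ hc
  have h1 : ∫ x, (u + v) x • gradient φ x = ∫ x, (u x • gradient φ x + v x • gradient φ x) := by
    refine integral_congr_ae ?_
    filter_upwards [Lp.coeFn_add u v] with x hx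
    rw [hx, Pi.add_apply, add_smul]
  have h2 : ∫ x, φ x • (g + k) x = ∫ x, (φ x • g x + φ x • k x) := by
    refine integral_congr_ae ?_
    filter_upwards [Lp.coeFn_add g k] with x hx
    rw [hx, Pi.add_apply, smul_add]
  rw [h1, h2, integral_add (integrable_smul_gradient u hφ hc) (integrable_smul_gradient v hφ hc),
    integral_add (integrable_test_smul g hφ hc) (integrable_test_smul k hφ hc), hu φ hφ hc,
    hv φ hφ hc, neg_add]

theorem HasWeakGradient.smul {u : L2 d} {g : L2Vec d} (hu : HasWeakGradient u g) (c : ℝ) :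
    HasWeakGradient (c • u) (c • g) := by
  intro φ hφ hc
  have h1 : ∫ x, (c • u) x • gradient φ x = ∫ x, c • (u x • gradient φ x) := by
    refine integral_congr_ae ?_
    filter_upwards [Lp.coeFn_smul c u] with x hx
    rw [hx, Pi.smul_apply, smul_assoc]
  have h2 : ∫ x, φ x • (c • g) x = ∫ x, c • (φ x • g x) := by
    refine integral_congr_ae ?_
    filter_upwards [Lp.coeFn_smul c g] with x hx
    rw [hx, Pi.smul_apply, smul_comm]
  rw [h1, h2, integral_smul, integral_smul, hu φ hφ hc, smul_neg]

theorem HasWeakGradient.sub {u v : L2 d} {g k : L2Vec d} (hu : HasWeakGradient u g)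
    (hv : HasWeakGradient v k) : HasWeakGradient (u - v) (g - k) := by
  have h := hu.add (hv.smul (-1))
  rwa [neg_one_smul, neg_one_smul, ← sub_eq_add_neg, ← sub_eq_add_neg] at h

/-- Integration by parts against a directional derivative. -/
theorem HasWeakGradient.integral_mul_fderiv {u : L2 d} {g : L2Vec d} (h : HasWeakGradient u g)
    {φ : Rd d → ℝ} (hφ : ContDiff ℝ ∞ φ) (hc : HasCompactSupport φ) (y : Rd d) :
    ∫ x, u x * fderiv ℝ φ x y = - ∫ x, φ x * inner ℝ y (g x) := by
  have h1 : ∫ x, u x * fderiv ℝ φ x y = ∫ x, inner ℝ y (u x • gradient φ x) := by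
    congr 1; ext x
    rw [inner_smul_right, real_inner_comm, gradient, InnerProductSpace.toDual_symm_apply]
  have h2 : ∫ x, φ x * inner ℝ y (g x) = ∫ x, inner ℝ y (φ x • g x) := by
    congr 1; ext x
    rw [inner_smul_right]
  rw [h1, h2, integral_inner (integrable_smul_gradient u hφ hc),
    integral_inner (integrable_test_smul g hφ hc), h φ hφ hc, inner_neg_right]

/-- The square of the `L²` norm as an integral. -/
theorem norm_sq_eq_integral {E : Type*} [NormedAddCommGroup E] [InnerProductSpace ℝ E]
    (f : Lp E 2 (volume : Measure (Rd d))) : ‖f‖ ^ 2 = ∫ x, ‖f x‖ ^ 2 := by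
  rw [← real_inner_self_eq_norm_sq, L2.inner_def]
  simp only [real_inner_self_eq_norm_sq]

theorem integrable_norm_sq {E : Type*} [NormedAddCommGroup E]
    (f : Lp E 2 (volume : Measure (Rd d))) : Integrable (fun x => ‖f x‖ ^ 2) :=
  (Lp.memLp f).integrable_norm_pow (by norm_num)

theorem lintegral_enorm_sq {E : Type*} [NormedAddCommGroup E] [InnerProductSpace ℝ E]
    (f : Lp E 2 (volume : Measure (Rd d))) :
    ∫⁻ x, ‖f x‖ₑ ^ 2 = ENNReal.ofReal (‖f‖ ^ 2) := by
  rw [norm_sq_eq_integral, ofReal_integral_eq_lintegral_ofReal (integrable_norm_sq f)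
    (Eventually.of_forall fun x => by positivity)]
  congr 1; ext x
  rw [ENNReal.ofReal_pow (norm_nonneg _), ofReal_norm]

theorem abs_integral_mul_inner_le (f : L2 d) (g : L2Vec d) (y : Rd d) :
    |∫ x, f x * inner ℝ y (g x)| ≤ ‖f‖ * (‖y‖ * ‖g‖) := by
  have h : ∫ x, f x * inner ℝ y (g x) = inner ℝ f ((innerSL ℝ y).compLp g) := by
    rw [L2.inner_def]
    refine integral_congr_ae ?_
    filter_upwards [(innerSL ℝ y).coeFn_compLp g] with x hx
    rw [hx]; simp [mul_comm]
  rw [h]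
  refine (abs_real_inner_le_norm _ _).trans (mul_le_mul_of_nonneg_left ?_ (norm_nonneg _))
  refine ((innerSL ℝ y).norm_compLp_le g).trans ?_
  rw [innerSL_apply_norm]

/-- Differentiation of `s ↦ ∫ u(x) φ(x + s y) dx`, which is a convolution restricted to a line. -/
theorem hasDerivAt_integral_translate (u : L2 d) {φ : Rd d → ℝ} (hφ : ContDiff ℝ ∞ φ)
    (hc : HasCompactSupport φ) (y : Rd d) (t : ℝ) :
    HasDerivAt (fun s : ℝ => ∫ x, u x * φ (x + s • y)) (∫ x, u x * fderiv ℝ φ (x + t • y) y) t := by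
  set ψ : Rd d → ℝ := fun x => φ (-x) with hψ
  have hψs : ContDiff ℝ 1 ψ := (hφ.comp contDiff_neg).of_le (by norm_cast)
  have hψc : HasCompactSupport ψ := hc.comp_homeomorph (Homeomorph.neg (Rd d))
  have hloc : LocallyIntegrable u (volume : Measure (Rd d)) :=
    (Lp.memLp u).locallyIntegrable (by norm_num)
  have h := hψc.hasFDerivAt_convolution_right (ContinuousLinearMap.mul ℝ ℝ) hloc hψs (-(t • y))
  have hline : HasDerivAt (fun s : ℝ => -(s • y)) (-y) t := by
    simpa using! ((hasDerivAt_id t).smul_const y).neg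
  have h2 := h.comp_hasDerivAt t hline
  have hex := (hψc.fderiv (𝕜 := ℝ)).convolutionExists_right
    ((ContinuousLinearMap.mul ℝ ℝ).precompR (Rd d)) hloc (hψs.continuous_fderiv (by simp))
    (-(t • y))
  have e1 : (fun s : ℝ => ∫ x, u x * φ (x + s • y)) =
      convolution u ψ (ContinuousLinearMap.mul ℝ ℝ) volume ∘ fun s => -(s • y) := by
    ext s
    simp only [Function.comp, convolution_def, hψ, ContinuousLinearMap.mul_apply']
    congr 1; ext x; congr 2; abel
  have e2 : ∫ x, u x * fderiv ℝ φ (x + t • y) y = (convolution u (fderiv ℝ ψ)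
      ((ContinuousLinearMap.mul ℝ ℝ).precompR (Rd d)) volume (-(t • y))) (-y) := by
    rw [convolution_def, ContinuousLinearMap.integral_apply hex]
    congr 1; ext x
    simp only [ContinuousLinearMap.precompR_apply, map_neg]
    have hd : fderiv ℝ ψ (-(t • y) - x) = -fderiv ℝ φ (x + t • y) := by
      have hz : -(-(t • y) - x) = x + t • y := by abel
      have h3 := (hφ.differentiable (by simp) (-(-(t • y) - x))).hasFDerivAt.comp (-(t • y) - x)
        (hasFDerivAt_id (𝕜 := ℝ) (-(t • y) - x)).neg
      rw [hz] at h3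
      have h4 : fderiv ℝ ψ (-(t • y) - x) = _ := h3.fderiv
      rw [h4]; ext; simp
    rw [hd]; simp
  rw [e1, e2]
  exact h2

/-- Translates of an `H¹` function paired with a test function: the dual form of
`‖u(· - y) - u‖ ≤ ‖y‖ ‖∇u‖`. -/
theorem HasWeakGradient.abs_integral_translate_sub_le {u : L2 d} {g : L2Vec d}
    (h : HasWeakGradient u g) {φ : Rd d → ℝ} (hφ : ContDiff ℝ ∞ φ) (hc : HasCompactSupport φ)
    (y : Rd d) (f : L2 d) (hf : f =ᵐ[volume] φ) :
    |(∫ x, u x * φ (x + y)) - ∫ x, u x * φ x| ≤ ‖f‖ * (‖y‖ * ‖g‖) := by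
  have hder := hasDerivAt_integral_translate u hφ hc y
  have hbound : ∀ t : ℝ, ‖∫ x, u x * fderiv ℝ φ (x + t • y) y‖ ≤ ‖f‖ * (‖y‖ * ‖g‖) := by
    intro t
    have hφt : ContDiff ℝ ∞ (fun x => φ (x + t • y)) := hφ.comp (contDiff_id.add contDiff_const)
    have hct : HasCompactSupport (fun x => φ (x + t • y)) :=
      hc.comp_homeomorph (Homeomorph.addRight (t • y))
    have h1 := h.integral_mul_fderiv hφt hct y
    simp only [fderiv_comp_add_right] at h1
    have hmp := measurePreserving_add_right (volume : Measure (Rd d)) (t • y)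
    have hft : Lp.compMeasurePreserving _ hmp f =ᵐ[volume] fun x => φ (x + t • y) :=
      (Lp.coeFn_compMeasurePreserving f hmp).trans
        (hmp.quasiMeasurePreserving.ae_eq_comp hf)
    rw [h1, Real.norm_eq_abs, abs_neg]
    have h2 : ∫ x, φ (x + t • y) * inner ℝ y (g x)
        = ∫ x, (Lp.compMeasurePreserving _ hmp f : L2 d) x * inner ℝ y (g x) := by
      refine integral_congr_ae ?_
      filter_upwards [hft] with x hx
      rw [hx]
    rw [h2]
    refine (abs_integral_mul_inner_le _ g y).trans (le_of_eq ?_)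
    rw [Lp.norm_compMeasurePreserving]
  have := Convex.norm_image_sub_le_of_norm_hasDerivWithin_le (s := univ)
    (f := fun s : ℝ => ∫ x, u x * φ (x + s • y)) (x := 0) (y := 1)
    (fun t _ => (hder t).hasDerivWithinAt) (fun t _ => hbound t) convex_univ trivial trivial
  simpa using this

/-- Translation estimate: `‖u(· + y) - u‖₂ ≤ ‖y‖ ‖∇u‖₂`. -/
theorem HasWeakGradient.lintegral_translate_sub_le {u : L2 d} {g : L2Vec d}
    (h : HasWeakGradient u g) (y : Rd d) :
    ∫⁻ x, ‖u (x + y) - u x‖ₑ ^ 2 ≤ ENNReal.ofReal ((‖y‖ * ‖g‖) ^ 2) := by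
  have hmp := measurePreserving_add_right (volume : Measure (Rd d)) y
  set w : L2 d := Lp.compMeasurePreserving _ hmp u - u with hw
  have hwx : w =ᵐ[volume] fun x => u (x + y) - u x := by
    filter_upwards [Lp.coeFn_sub (Lp.compMeasurePreserving _ hmp u) u,
      Lp.coeFn_compMeasurePreserving u hmp] with x h1 h2
    rw [hw, h1, Pi.sub_apply, h2]; rfl
  have hdual : ∀ f : L2 d, inner ℝ w f ≤ ‖f‖ * (‖y‖ * ‖g‖) := by
    intro f
    have hcl : IsClosed {f : L2 d | inner ℝ w f ≤ ‖f‖ * (‖y‖ * ‖g‖)} :=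
      isClosed_le (by fun_prop) (by fun_prop)
    have hdense := Lp.dense_hasCompactSupport_contDiff (E := Rd d) (F := ℝ)
      (μ := (volume : Measure (Rd d))) (p := 2) (by norm_num)
    refine hcl.closure_subset_iff.2 ?_ (hdense f)
    rintro f ⟨φ, hfφ, hc, hφ⟩
    have hφ2 : MemLp φ 2 (volume : Measure (Rd d)) := hφ.continuous.memLp_of_hasCompactSupport hc
    have hsub : ∫ x, u (x + y) * φ x = ∫ x, u x * φ (x - y) := by
      have := integral_add_right_eq_self (μ := (volume : Measure (Rd d)))
        (fun x => u x * φ (x - y)) y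
      simpa using this
    have hin : inner ℝ w f = (∫ x, u x * φ (x + (-y))) - ∫ x, u x * φ x := by
      rw [L2.inner_def]
      have e1 : ∫ x, inner ℝ (w x) (f x) = ∫ x, (u (x + y) * φ x - u x * φ x) := by
        refine integral_congr_ae ?_
        filter_upwards [hwx, hfφ] with x h1 h2
        rw [h1, h2]; simp; ring
      rw [e1, integral_sub, hsub]
      · simp [sub_eq_add_neg]
      · exact MemLp.integrable_mul (p := 2) (q := 2)
          ((Lp.memLp u).comp_measurePreserving hmp) hφ2
      · exact MemLp.integrable_mul (p := 2) (q := 2) (Lp.memLp u) hφ2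
    rw [mem_ofPred_eq, hin]
    have := h.abs_integral_translate_sub_le hφ hc (-y) f hfφ
    rw [norm_neg] at this
    exact (le_abs_self _).trans this
  have hnorm : ‖w‖ ≤ ‖y‖ * ‖g‖ := by
    have h1 := hdual w
    rw [real_inner_self_eq_norm_sq, sq] at h1
    rcases (norm_nonneg w).eq_or_lt with h0 | h0
    · rw [← h0]; positivity
    · exact le_of_mul_le_mul_left h1 h0
  calc ∫⁻ x, ‖u (x + y) - u x‖ₑ ^ 2 = ∫⁻ x, ‖w x‖ₑ ^ 2 := by
        refine lintegral_congr_ae ?_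
        filter_upwards [hwx] with x hx
        rw [hx]
    _ = ENNReal.ofReal (‖w‖ ^ 2) := lintegral_enorm_sq w
    _ ≤ _ := ENNReal.ofReal_le_ofReal (pow_le_pow_left₀ (norm_nonneg _) hnorm 2)

/-! ### Superlevel sets and the subcritical Gagliardo-Nirenberg inequality -/

/-- The translation estimate averaged over a ball of translations. -/
theorem HasWeakGradient.lintegral_lintegral_ball_sub_le {u : L2 d} {g : L2Vec d}
    (h : HasWeakGradient u g) (r : ℝ) :
    ∫⁻ x, ∫⁻ y in Metric.ball (0 : Rd d) r, ‖u (x + y) - u x‖ₑ ^ 2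
      ≤ volume (Metric.ball (0 : Rd d) r) * ENNReal.ofReal ((r * ‖g‖) ^ 2) := by
  have hm : Measurable u := (Lp.stronglyMeasurable u).measurable
  rw [lintegral_lintegral_swap (by fun_prop)]
  calc ∫⁻ y in Metric.ball (0 : Rd d) r, ∫⁻ x, ‖u (x + y) - u x‖ₑ ^ 2
      ≤ ∫⁻ _ in Metric.ball (0 : Rd d) r, ENNReal.ofReal ((r * ‖g‖) ^ 2) := by
        refine setLIntegral_mono measurable_const fun y hy => ?_
        refine (h.lintegral_translate_sub_le y).trans (ENNReal.ofReal_le_ofReal ?_)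
        rw [mem_ball_zero_iff] at hy
        gcongr
    _ = _ := by rw [setLIntegral_const, mul_comm]

theorem enorm_sq_le_two_mul (a b : ℝ) : ‖a‖ₑ ^ 2 ≤ 2 * ‖b - a‖ₑ ^ 2 + 2 * ‖b‖ₑ ^ 2 := by
  have key : ∀ x : ℝ, ‖x‖ₑ ^ 2 = ENNReal.ofReal (x ^ 2) := fun x => by
    rw [Real.enorm_eq_ofReal_abs, ← ENNReal.ofReal_pow (abs_nonneg _), sq_abs]
  have h2 : (2 : ℝ≥0∞) = ENNReal.ofReal 2 := by simp
  rw [key, key, key, h2, ← ENNReal.ofReal_mul (by norm_num), ← ENNReal.ofReal_mul (by norm_num),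
    ← ENNReal.ofReal_add (by positivity) (by positivity)]
  refine ENNReal.ofReal_le_ofReal ?_
  nlinarith [sq_nonneg (a - 2 * b)]

/-- An `H¹` function has little mass where it is large: where `|u|` exceeds the size that its
averages over balls of radius `r` can have, `u` differs from these averages by at least half of
its size, and `u` is close to its averages in `L²`. -/
theorem HasWeakGradient.lintegral_superlevel_le {u : L2 d} {g : L2Vec d}
    (h : HasWeakGradient u g) {r l : ℝ} (hr : 0 < r) (hl : 0 ≤ l)
    (hlr : 4 * ‖u‖ ^ 2 ≤ l ^ 2 * (volume (Metric.ball (0 : Rd d) r)).toReal) :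
    ∫⁻ x in {x | l ≤ |u x|}, ‖u x‖ₑ ^ 2 ≤ ENNReal.ofReal (4 * (r * ‖g‖) ^ 2) := by
  have hm : Measurable u := (Lp.stronglyMeasurable u).measurable
  set B := Metric.ball (0 : Rd d) r with hB
  set m := volume B with hm'
  have hm0 : m ≠ 0 := (Metric.measure_ball_pos volume _ hr).ne'
  have hmt : m ≠ ⊤ := measure_ball_lt_top.ne
  have hpt : ∀ x ∈ {x | l ≤ |u x|},
      m * ‖u x‖ₑ ^ 2 ≤ 4 * ∫⁻ y in B, ‖u (x + y) - u x‖ₑ ^ 2 := by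
    intro x hx
    have h1 : m * ‖u x‖ₑ ^ 2 ≤ 2 * (∫⁻ y in B, ‖u (x + y) - u x‖ₑ ^ 2)
        + 2 * ENNReal.ofReal (‖u‖ ^ 2) := by
      calc m * ‖u x‖ₑ ^ 2 = ∫⁻ _ in B, ‖u x‖ₑ ^ 2 := by rw [setLIntegral_const, mul_comm]
        _ ≤ ∫⁻ y in B, (2 * ‖u (x + y) - u x‖ₑ ^ 2 + 2 * ‖u (x + y)‖ₑ ^ 2) :=
          lintegral_mono fun y => enorm_sq_le_two_mul _ _
        _ = 2 * (∫⁻ y in B, ‖u (x + y) - u x‖ₑ ^ 2) + 2 * ∫⁻ y in B, ‖u (x + y)‖ₑ ^ 2 := by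
          rw [lintegral_add_left (by fun_prop), lintegral_const_mul _ (by fun_prop),
            lintegral_const_mul _ (by fun_prop)]
        _ ≤ _ := by
          gcongr
          refine (setLIntegral_le_lintegral _ _).trans (le_of_eq ?_)
          rw [lintegral_add_left_eq_self (fun y => ‖u y‖ₑ ^ 2) x, lintegral_enorm_sq]
    have h2 : 4 * ENNReal.ofReal (‖u‖ ^ 2) ≤ m * ‖u x‖ₑ ^ 2 := by
      have e4 : (4 : ℝ≥0∞) = ENNReal.ofReal 4 := by simp
      rw [e4, ← ENNReal.ofReal_mul (by norm_num), Real.enorm_eq_ofReal_abs,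
        ← ENNReal.ofReal_pow (abs_nonneg _), ← ENNReal.ofReal_toReal hmt,
        ← ENNReal.ofReal_mul ENNReal.toReal_nonneg]
      refine ENNReal.ofReal_le_ofReal (hlr.trans ?_)
      rw [mul_comm]
      gcongr
      exact hx
    have hfin : m * ‖u x‖ₑ ^ 2 ≠ ⊤ := ENNReal.mul_ne_top hmt (by simp)
    rw [← ENNReal.add_le_add_iff_right hfin]
    calc m * ‖u x‖ₑ ^ 2 + m * ‖u x‖ₑ ^ 2 = 2 * (m * ‖u x‖ₑ ^ 2) := by ring
      _ ≤ 2 * (2 * (∫⁻ y in B, ‖u (x + y) - u x‖ₑ ^ 2) + 2 * ENNReal.ofReal (‖u‖ ^ 2)) := by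
        gcongr
      _ = 4 * (∫⁻ y in B, ‖u (x + y) - u x‖ₑ ^ 2) + 4 * ENNReal.ofReal (‖u‖ ^ 2) := by ring
      _ ≤ _ := by gcongr
  have hS : MeasurableSet {x | l ≤ |u x|} := measurableSet_le measurable_const hm.abs
  rw [← ENNReal.mul_le_mul_iff_right hm0 hmt]
  calc m * ∫⁻ x in {x | l ≤ |u x|}, ‖u x‖ₑ ^ 2 = ∫⁻ x in {x | l ≤ |u x|}, m * ‖u x‖ₑ ^ 2 := by
        rw [lintegral_const_mul _ (by fun_prop)]
    _ ≤ ∫⁻ x in {x | l ≤ |u x|}, 4 * ∫⁻ y in B, ‖u (x + y) - u x‖ₑ ^ 2 :=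
        setLIntegral_mono' hS hpt
    _ ≤ ∫⁻ x, 4 * ∫⁻ y in B, ‖u (x + y) - u x‖ₑ ^ 2 := setLIntegral_le_lintegral _ _
    _ = 4 * ∫⁻ x, ∫⁻ y in B, ‖u (x + y) - u x‖ₑ ^ 2 := by
        rw [lintegral_const_mul]
        exact Measurable.lintegral_prod_right' (f := fun z : Rd d × Rd d =>
          ‖u (z.1 + z.2) - u z.1‖ₑ ^ 2) (by fun_prop)
    _ ≤ 4 * (m * ENNReal.ofReal ((r * ‖g‖) ^ 2)) := by
        gcongr
        exact h.lintegral_lintegral_ball_sub_le r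
    _ = m * ENNReal.ofReal (4 * (r * ‖g‖) ^ 2) := by
        rw [ENNReal.ofReal_mul (by norm_num)]
        simp only [ENNReal.ofReal_ofNat]
        ring

/-- In the mass-subcritical range the part of `∫ |u|^(p+1)` coming from high levels is a small
multiple of `‖∇u‖²`, uniformly for bounded mass. -/
theorem exists_level_lintegral_rpow_le (hd : 1 ≤ d) {p : ℝ} (hp : 1 < p)
    (hp' : p < 1 + 4 / (d : ℝ)) (M : ℝ) {ε : ℝ} (hε : 0 < ε) :
    ∃ Λ : ℝ, 0 < Λ ∧ ∀ (u : L2 d) (g : L2Vec d), HasWeakGradient u g → ‖u‖ ≤ M →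
      ∫⁻ x in {x | Λ ≤ |u x|}, ENNReal.ofReal (|u x| ^ (p + 1))
        ≤ ENNReal.ofReal (ε * ‖g‖ ^ 2) := by
  have hd0 : (0 : ℝ) < d := by exact_mod_cast hd
  set m : ℝ := (volume (Metric.ball (0 : Rd d) 1)).toReal with hm
  have hm0 : 0 < m := ENNReal.toReal_pos (Metric.measure_ball_pos volume _ one_pos).ne'
    measure_ball_lt_top.ne
  set L : ℝ := 2 * (|M| + 1) / √m with hL
  have hL0 : 0 < L := by positivity
  have hLm : L ^ 2 * m = 4 * (|M| + 1) ^ 2 := by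
    rw [hL, div_pow, Real.sq_sqrt hm0.le]; field_simp; ring
  -- with this ratio of heights, `(L * b ^ k) ^ 2` times the volume of the ball of radius
  -- `2 ^ (-k)` does not depend on `k`, and `L` is chosen so that the level estimate applies
  set b : ℝ := (2 : ℝ) ^ ((d : ℝ) / 2) with hb
  have hb1 : 1 < b := Real.one_lt_rpow (by norm_num) (by positivity)
  have hb0 : 0 < b := one_pos.trans hb1
  have hb2 : b ^ 2 = 2 ^ d := by
    rw [hb, ← Real.rpow_natCast, ← Real.rpow_mul (by norm_num), ← Real.rpow_natCast]
    congr 1; push_cast; ring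
  set θ : ℝ := b ^ (p - 1) / 4 with hθ
  have hθ0 : 0 < θ := by positivity
  -- `θ` is the ratio of the dyadic series; it is below one exactly in the subcritical range
  have hθ1 : θ < 1 := by
    rw [hθ, div_lt_one (by norm_num), hb, ← Real.rpow_mul (by norm_num)]
    have h4 : (4 : ℝ) = 2 ^ (2 : ℝ) := by norm_num
    rw [h4]
    refine Real.rpow_lt_rpow_of_exponent_lt (by norm_num) ?_
    have : (p - 1) * d < 4 := by
      rw [← lt_div_iff₀ hd0]; linarith
    linarith
  set C : ℝ := 4 * (L * b) ^ (p - 1) with hC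
  have hC0 : 0 < C := by positivity
  obtain ⟨j, hj⟩ : ∃ j : ℕ, C * θ ^ j / (1 - θ) ≤ ε := by
    have ht : Tendsto (fun j : ℕ => C * θ ^ j / (1 - θ)) atTop (𝓝 (C * 0 / (1 - θ))) :=
      ((tendsto_pow_atTop_nhds_zero_of_lt_one hθ0.le hθ1).const_mul C).div_const _
    rw [mul_zero, zero_div] at ht
    exact (ht.eventually (ge_mem_nhds hε)).exists
  refine ⟨L * b ^ j, by positivity, fun u g h huM => ?_⟩
  have hmu : Measurable u := (Lp.stronglyMeasurable u).measurable
  -- the level estimate at height `L * b ^ k`, with averages over balls of radius `2 ^ (-k)`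
  have hlev : ∀ k : ℕ, ∫⁻ x in {x | L * b ^ k ≤ |u x|}, ‖u x‖ₑ ^ 2
      ≤ ENNReal.ofReal (4 * ((1 / 2) ^ k * ‖g‖) ^ 2) := by
    intro k
    refine h.lintegral_superlevel_le (by positivity) (by positivity) ?_
    have hv : (volume (Metric.ball (0 : Rd d) ((1 / 2) ^ k))).toReal = ((1 / 2) ^ k) ^ d * m := by
      rw [Measure.addHaar_ball_of_pos _ _ (by positivity), ENNReal.toReal_mul, finrank_euclideanSpace_fin,
        ENNReal.toReal_ofReal (by positivity)]
    rw [hv]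
    have e : (L * b ^ k) ^ 2 * (((1 / 2) ^ k) ^ d * m) = L ^ 2 * m := by
      have : (b ^ k) ^ 2 * ((1 / 2 : ℝ) ^ k) ^ d = 1 := by
        rw [← pow_mul, mul_comm k 2, pow_mul, hb2, ← pow_mul, ← pow_mul, mul_comm k d, ← mul_pow]
        norm_num
      calc _ = ((b ^ k) ^ 2 * ((1 / 2 : ℝ) ^ k) ^ d) * (L ^ 2 * m) := by ring
        _ = _ := by rw [this, one_mul]
    rw [e, hLm]
    have : ‖u‖ ≤ |M| + 1 := by linarith [le_abs_self M]
    gcongr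
  have hSm : ∀ k : ℕ, MeasurableSet {x | L * b ^ k ≤ |u x|} := fun k =>
    measurableSet_le measurable_const hmu.abs
  -- the dyadic decomposition of `{x | L * b ^ j ≤ |u x|}` into shells
  have hpt : ∀ x ∈ {x | L * b ^ j ≤ |u x|}, ENNReal.ofReal (|u x| ^ (p + 1)) ≤
      ∑' n : ℕ, ENNReal.ofReal ((L * b ^ (j + n + 1)) ^ (p - 1)) *
        indicator {x | L * b ^ (j + n) ≤ |u x|} (fun x => ‖u x‖ₑ ^ 2) x := by
    intro x hx
    have hpos : 0 < L * b ^ j := by positivity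
    have hx' : L * b ^ j ≤ |u x| := hx
    obtain ⟨n, hn1, hn2⟩ := exists_nat_pow_near ((one_le_div hpos).2 hx') hb1
    rw [le_div_iff₀ hpos] at hn1
    rw [div_lt_iff₀ hpos] at hn2
    refine le_trans ?_ (ENNReal.le_tsum n)
    have hmem : x ∈ {x | L * b ^ (j + n) ≤ |u x|} := by
      rw [mem_ofPred_eq]; refine le_trans (le_of_eq ?_) hn1; rw [pow_add]; ring
    have hux : 0 < |u x| := hpos.trans_le hx'
    rw [indicator_of_mem hmem, Real.enorm_eq_ofReal_abs, ← ENNReal.ofReal_pow (abs_nonneg _),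
      ← ENNReal.ofReal_mul (by positivity)]
    refine ENNReal.ofReal_le_ofReal ?_
    have e : |u x| ^ (p + 1) = |u x| ^ (p - 1) * |u x| ^ 2 := by
      rw [← Real.rpow_natCast, ← Real.rpow_add hux]; congr 1; push_cast; ring
    rw [e]
    have hle : |u x| ≤ L * b ^ (j + n + 1) := by
      refine hn2.le.trans (le_of_eq ?_); rw [pow_add, pow_add, pow_add]; ring
    gcongr
  have hterm : ∀ n : ℕ, (L * b ^ (j + n + 1)) ^ (p - 1) * (4 * ((1 / 2) ^ (j + n) * ‖g‖) ^ 2)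
      = C * θ ^ j * ‖g‖ ^ 2 * θ ^ n := by
    intro n
    have e1 : (L * b ^ (j + n + 1)) ^ (p - 1) = (L * b) ^ (p - 1) * (b ^ (p - 1)) ^ (j + n) := by
      rw [pow_succ, ← mul_assoc, mul_right_comm, Real.mul_rpow (by positivity) (by positivity),
        ← Real.rpow_natCast b (j + n), ← Real.rpow_mul hb0.le, mul_comm ((j + n : ℕ) : ℝ),
        Real.rpow_mul hb0.le, Real.rpow_natCast]
    have e2 : ((1 / 2 : ℝ) ^ (j + n)) ^ 2 = (1 / 4) ^ (j + n) := by
      rw [← pow_mul, mul_comm, pow_mul]; norm_num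
    have e3 : θ ^ j * θ ^ n = (b ^ (p - 1)) ^ (j + n) * (1 / 4) ^ (j + n) := by
      rw [← pow_add, ← mul_pow, hθ]; congr 1; ring
    calc _ = 4 * (L * b) ^ (p - 1) * ‖g‖ ^ 2 *
          ((b ^ (p - 1)) ^ (j + n) * ((1 / 2 : ℝ) ^ (j + n)) ^ 2) := by rw [e1]; ring
      _ = _ := by rw [e2, ← e3, hC]; ring
  calc ∫⁻ x in {x | L * b ^ j ≤ |u x|}, ENNReal.ofReal (|u x| ^ (p + 1))
      ≤ ∫⁻ x in {x | L * b ^ j ≤ |u x|},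
        ∑' n : ℕ, ENNReal.ofReal ((L * b ^ (j + n + 1)) ^ (p - 1)) *
        indicator {x | L * b ^ (j + n) ≤ |u x|} (fun x => ‖u x‖ₑ ^ 2) x :=
        setLIntegral_mono' (hSm j) hpt
    _ ≤ ∫⁻ x, ∑' n : ℕ, ENNReal.ofReal ((L * b ^ (j + n + 1)) ^ (p - 1)) *
        indicator {x | L * b ^ (j + n) ≤ |u x|} (fun x => ‖u x‖ₑ ^ 2) x :=
        setLIntegral_le_lintegral _ _
    _ = ∑' n : ℕ, ENNReal.ofReal ((L * b ^ (j + n + 1)) ^ (p - 1)) *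
        ∫⁻ x in {x | L * b ^ (j + n) ≤ |u x|}, ‖u x‖ₑ ^ 2 := by
        rw [lintegral_tsum fun n => (((hmu.enorm.pow_const 2).indicator
          (hSm (j + n))).const_mul _).aemeasurable]
        congr 1; ext n
        rw [lintegral_const_mul _ ((hmu.enorm.pow_const 2).indicator (hSm (j + n))),
          lintegral_indicator (hSm (j + n))]
    _ ≤ ∑' n : ℕ, ENNReal.ofReal (C * θ ^ j * ‖g‖ ^ 2 * θ ^ n) := by
        refine ENNReal.tsum_le_tsum fun n => ?_
        rw [← hterm, ENNReal.ofReal_mul (by positivity)]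
        gcongr
        exact hlev (j + n)
    _ = ENNReal.ofReal (C * θ ^ j / (1 - θ) * ‖g‖ ^ 2) := by
        rw [← ENNReal.ofReal_tsum_of_nonneg (fun n => by positivity)
          ((summable_geometric_of_lt_one hθ0.le hθ1).mul_left _), tsum_mul_left,
          tsum_geometric_of_lt_one hθ0.le hθ1]
        congr 1; ring
    _ ≤ _ := ENNReal.ofReal_le_ofReal (by gcongr)

/-- The mass-subcritical Gagliardo-Nirenberg inequality in additive form. -/
theorem exists_lintegral_rpow_le (hd : 1 ≤ d) {p : ℝ} (hp : 1 < p)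
    (hp' : p < 1 + 4 / (d : ℝ)) (M : ℝ) {ε : ℝ} (hε : 0 < ε) :
    ∃ C : ℝ, 0 < C ∧ ∀ (u : L2 d) (g : L2Vec d), HasWeakGradient u g → ‖u‖ ≤ M →
      ∫⁻ x, ENNReal.ofReal (|u x| ^ (p + 1))
        ≤ ENNReal.ofReal (C * ‖u‖ ^ 2 + ε * ‖g‖ ^ 2) := by
  obtain ⟨Λ, hΛ, H⟩ := exists_level_lintegral_rpow_le hd hp hp' M hε
  refine ⟨Λ ^ (p - 1), by positivity, fun u g h huM => ?_⟩
  have hmu : Measurable u := (Lp.stronglyMeasurable u).measurable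
  have hS : MeasurableSet {x | Λ ≤ |u x|} := measurableSet_le measurable_const hmu.abs
  rw [← lintegral_add_compl _ hS, add_comm, ENNReal.ofReal_add (by positivity) (by positivity)]
  refine add_le_add ?_ (H u g h huM)
  calc ∫⁻ x in {x | Λ ≤ |u x|}ᶜ, ENNReal.ofReal (|u x| ^ (p + 1))
      ≤ ∫⁻ x in {x | Λ ≤ |u x|}ᶜ, ENNReal.ofReal (Λ ^ (p - 1)) * ‖u x‖ₑ ^ 2 := by
        refine setLIntegral_mono' hS.compl fun x hx => ?_
        have hx' : |u x| < Λ := not_le.1 hx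
        rw [Real.enorm_eq_ofReal_abs, ← ENNReal.ofReal_pow (abs_nonneg _),
          ← ENNReal.ofReal_mul (by positivity)]
        refine ENNReal.ofReal_le_ofReal ?_
        rcases (abs_nonneg (u x)).eq_or_lt with h0 | h0
        · rw [← h0, Real.zero_rpow (by linarith)]; positivity
        have e : |u x| ^ (p + 1) = |u x| ^ (p - 1) * |u x| ^ 2 := by
          rw [← Real.rpow_natCast, ← Real.rpow_add h0]; congr 1; push_cast; ring
        rw [e]
        gcongr
    _ ≤ ∫⁻ x, ENNReal.ofReal (Λ ^ (p - 1)) * ‖u x‖ₑ ^ 2 := setLIntegral_le_lintegral _ _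
    _ = _ := by
        rw [lintegral_const_mul _ (by fun_prop), lintegral_enorm_sq,
          ← ENNReal.ofReal_mul (by positivity)]

/-! ### Weak compactness and compactness of the embedding into `L²` -/

/-- Sequential weak compactness of bounded sets in a separable Hilbert space. -/
theorem exists_subseq_tendsto_inner {H : Type*} [NormedAddCommGroup H] [InnerProductSpace ℝ H]
    [CompleteSpace H] [SecondCountableTopology H] (x : ℕ → H) (C : ℝ) (hx : ∀ n, ‖x n‖ ≤ C) :
    ∃ (a : H) (ns : ℕ → ℕ), StrictMono ns ∧
      ∀ y, Tendsto (fun n => (inner ℝ (x (ns n)) y : ℝ)) atTop (𝓝 (inner ℝ a y)) := by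
  let T : H → WeakDual ℝ H := fun z => StrongDual.toWeakDual (InnerProductSpace.toDual ℝ H z)
  have hmem : ∀ n, T (x n) ∈
      WeakDual.toStrongDual ⁻¹' Metric.closedBall (0 : StrongDual ℝ H) C := by
    intro n
    simpa [T] using! hx n
  obtain ⟨ℓ, -, ns, hns, hlim⟩ := WeakDual.isSeqCompact_closedBall ℝ H 0 C hmem
  refine ⟨(InnerProductSpace.toDual ℝ H).symm (WeakDual.toStrongDual ℓ), ns, hns, fun y => ?_⟩
  have h := ((WeakDual.eval_continuous y).tendsto ℓ).comp hlim
  rw [InnerProductSpace.toDual_symm_apply]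
  exact h

/-- Both sides of the weak gradient identity, in a fixed direction, are inner products with fixed
`L²` functions. -/
theorem exists_inner_eq_of_test {φ : Rd d → ℝ} (hφ : ContDiff ℝ ∞ φ) (hc : HasCompactSupport φ)
    (y : Rd d) : ∃ (a : L2 d) (b : L2Vec d), ∀ (u : L2 d) (g : L2Vec d),
      inner ℝ y (∫ x, u x • gradient φ x) = inner ℝ u a ∧
      inner ℝ y (∫ x, φ x • g x) = inner ℝ g b := by
  have ha : MemLp (fun x => inner ℝ y (gradient φ x)) 2 (volume : Measure (Rd d)) := by
    refine Continuous.memLp_of_hasCompactSupport ?_ ?_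
    · exact continuous_const.inner (continuous_gradient_of_contDiff hφ)
    · exact (hasCompactSupport_gradient hc).comp_left (g := fun z => inner ℝ y z)
        (inner_zero_right _)
  have hb : MemLp (fun x => φ x • y) 2 (volume : Measure (Rd d)) :=
    Continuous.memLp_of_hasCompactSupport (hφ.continuous.smul continuous_const) hc.smul_right
  refine ⟨ha.toLp, hb.toLp, fun u g => ⟨?_, ?_⟩⟩
  · rw [← integral_inner (integrable_smul_gradient u hφ hc), L2.inner_def]
    refine integral_congr_ae ?_
    filter_upwards [ha.coeFn_toLp] with x hx
    rw [hx, inner_smul_right]; simp [mul_comm]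
  · rw [← integral_inner (integrable_test_smul g hφ hc), L2.inner_def]
    refine integral_congr_ae ?_
    filter_upwards [hb.coeFn_toLp] with x hx
    rw [hx, inner_smul_right, inner_smul_right, real_inner_comm]

theorem hasWeakGradient_of_tendsto_inner {u : ℕ → L2 d} {g : ℕ → L2Vec d} {U : L2 d} {G : L2Vec d}
    (h : ∀ n, HasWeakGradient (u n) (g n))
    (hu : ∀ y, Tendsto (fun n => (inner ℝ (u n) y : ℝ)) atTop (𝓝 (inner ℝ U y)))
    (hg : ∀ y, Tendsto (fun n => (inner ℝ (g n) y : ℝ)) atTop (𝓝 (inner ℝ G y))) :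
    HasWeakGradient U G := by
  intro φ hφ hc
  refine ext_inner_left ℝ fun y => ?_
  obtain ⟨a, b, hab⟩ := exists_inner_eq_of_test hφ hc y
  rw [inner_neg_right, (hab U G).1, (hab U G).2]
  refine tendsto_nhds_unique (hu a) ?_
  refine (hg b).neg.congr fun n => ?_
  rw [← (hab (u n) (g n)).1, ← (hab (u n) (g n)).2, ← inner_neg_right, ← h n φ hφ hc]

theorem sq_lintegral_le {α : Type*} [MeasurableSpace α] (μ : Measure α) {f : α → ℝ≥0∞}
    (hf : AEMeasurable f μ) : (∫⁻ x, f x ∂μ) ^ 2 ≤ μ univ * ∫⁻ x, f x ^ 2 ∂μ := by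
  have h := ENNReal.lintegral_mul_le_Lp_mul_Lq μ Real.HolderConjugate.two_two hf
    (aemeasurable_const (b := (1 : ℝ≥0∞)))
  simp only [Pi.mul_apply, mul_one, ENNReal.one_rpow, lintegral_const, one_mul] at h
  calc (∫⁻ x, f x ∂μ) ^ 2
      ≤ ((∫⁻ x, f x ^ (2 : ℝ) ∂μ) ^ (1 / 2 : ℝ) * μ univ ^ (1 / 2 : ℝ)) ^ 2 := by gcongr
    _ = μ univ * ∫⁻ x, f x ^ 2 ∂μ := by
      rw [mul_pow, ← ENNReal.rpow_natCast, ← ENNReal.rpow_natCast, ← ENNReal.rpow_mul,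
        ← ENNReal.rpow_mul, mul_comm]
      norm_num

theorem integrableOn_translate_ball (w : L2 d) (x : Rd d) (r : ℝ) :
    IntegrableOn (fun y => w (x + y)) (Metric.ball 0 r) := by
  have hmp := measurePreserving_add_left (volume : Measure (Rd d)) x
  have h := ((Lp.memLp w).comp_measurePreserving hmp).restrict (Metric.ball 0 r)
  have : IsFiniteMeasure ((volume : Measure (Rd d)).restrict (Metric.ball 0 r)) :=
    ⟨by simpa using measure_ball_lt_top⟩
  exact h.integrable (by norm_num)

/-- Pointwise comparison of an `L²` function with its averages over balls. -/
theorem enorm_sq_le_average (w : L2 d) (r : ℝ) (x : Rd d) :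
    volume (Metric.ball (0 : Rd d) r) ^ 2 * ‖w x‖ₑ ^ 2 ≤
      2 * (volume (Metric.ball (0 : Rd d) r) *
        ∫⁻ y in Metric.ball (0 : Rd d) r, ‖w (x + y) - w x‖ₑ ^ 2)
      + 2 * ‖∫ y in Metric.ball (0 : Rd d) r, w (x + y)‖ₑ ^ 2 := by
  have hmw : Measurable w := (Lp.stronglyMeasurable w).measurable
  set B := Metric.ball (0 : Rd d) r
  have hBt : volume B ≠ ⊤ := measure_ball_lt_top.ne
  have hint := integrableOn_translate_ball w x r
  set a := ∫ y in B, w (x + y) with ha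
  have hsub : ∫ y in B, (w (x + y) - w x) = a - (volume B).toReal * w x := by
    rw [integral_sub hint (integrableOn_const hBt), setIntegral_const, smul_eq_mul]; rfl
  calc volume B ^ 2 * ‖w x‖ₑ ^ 2 = ‖(volume B).toReal * w x‖ₑ ^ 2 := by
        rw [enorm_mul, mul_pow, Real.enorm_of_nonneg ENNReal.toReal_nonneg,
          ENNReal.ofReal_toReal hBt]
    _ ≤ 2 * ‖∫ y in B, (w (x + y) - w x)‖ₑ ^ 2 + 2 * ‖a‖ₑ ^ 2 := by
        rw [hsub]; exact enorm_sq_le_two_mul _ _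
    _ ≤ _ := by
        gcongr
        refine (pow_le_pow_left₀ (by simp) (enorm_integral_le_lintegral_enorm _) 2).trans ?_
        refine (sq_lintegral_le _ (by fun_prop)).trans (le_of_eq ?_)
        rw [Measure.restrict_apply_univ]

theorem integral_translate_ball_eq_inner (w : L2 d) (r : ℝ) (x : Rd d) :
    ∫ y in Metric.ball (0 : Rd d) r, w (x + y) =
      inner ℝ (indicatorConstLp 2 (measurableSet_ball (x := x) (ε := r))
        (measure_ball_lt_top (μ := (volume : Measure (Rd d)))).ne (1 : ℝ)) w := by
  rw [L2.inner_indicatorConstLp_one]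
  have hmp := measurePreserving_add_left (volume : Measure (Rd d)) x
  have h := hmp.setIntegral_preimage_emb (measurableEmbedding_addLeft x) (fun z => w z)
    (Metric.ball x r)
  have hpre : (fun y => x + y) ⁻¹' Metric.ball x r = Metric.ball (0 : Rd d) r := by
    ext y; simp [Metric.mem_ball, dist_eq_norm]
  rw [← h, hpre]

/-- A weakly null sequence in `L²` with bounded weak gradients converges to zero in `L²` on
bounded sets. -/
theorem tendsto_lintegral_ball_of_tendsto_inner {w : ℕ → L2 d} {k : ℕ → L2Vec d}
    (h : ∀ n, HasWeakGradient (w n) (k n)) {M K : ℝ} (hM : ∀ n, ‖w n‖ ≤ M) (hK : ∀ n, ‖k n‖ ≤ K)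
    (hw : ∀ y, Tendsto (fun n => (inner ℝ (w n) y : ℝ)) atTop (𝓝 0)) (R : ℝ) :
    Tendsto (fun n => ∫⁻ x in Metric.ball (0 : Rd d) R, ‖w n x‖ₑ ^ 2) atTop (𝓝 0) := by
  have hK0 : 0 ≤ K := (norm_nonneg _).trans (hK 0)
  have hM0 : 0 ≤ M := (norm_nonneg _).trans (hM 0)
  -- the averages over balls of a fixed radius `r` tend to zero, and `r` can be taken small
  have key : ∀ r : ℝ, 0 < r → ∀ᶠ n in atTop,
      ∫⁻ x in Metric.ball (0 : Rd d) R, ‖w n x‖ₑ ^ 2 ≤ ENNReal.ofReal (2 * (r * K) ^ 2 + r) := by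
    intro r hr
    set B := Metric.ball (0 : Rd d) r
    set m := volume B with hmdef
    have hm0 : m ≠ 0 := (Metric.measure_ball_pos volume _ hr).ne'
    have hmt : m ≠ ⊤ := measure_ball_lt_top.ne
    set a : ℕ → Rd d → ℝ := fun n x => ∫ y in B, w n (x + y) with ha
    have hameas : ∀ n, Measurable (a n) := by
      intro n
      have hmw := Lp.stronglyMeasurable (w n)
      have : StronglyMeasurable (a n) :=
        StronglyMeasurable.integral_prod_right (ν := volume.restrict B)
          (f := fun x y => w n (x + y)) (hmw.comp_measurable (by fun_prop))
      exact this.measurable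
    have hlim : Tendsto (fun n => ∫⁻ x in Metric.ball (0 : Rd d) R, ‖a n x‖ₑ ^ 2) atTop
        (𝓝 (∫⁻ x in Metric.ball (0 : Rd d) R, 0)) := by
      refine tendsto_lintegral_of_dominated_convergence
        (fun _ => ENNReal.ofReal ((√m.toReal * M) ^ 2)) (fun n => by fun_prop) ?_ ?_ ?_
      · intro n
        refine Eventually.of_forall fun x => ?_
        change ‖a n x‖ₑ ^ 2 ≤ ENNReal.ofReal ((√m.toReal * M) ^ 2)
        rw [Real.enorm_eq_ofReal_abs, ← ENNReal.ofReal_pow (abs_nonneg _)]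
        refine ENNReal.ofReal_le_ofReal (pow_le_pow_left₀ (abs_nonneg _) ?_ 2)
        simp only [ha]
        rw [integral_translate_ball_eq_inner]
        refine (abs_real_inner_le_norm _ _).trans ?_
        have hn : ‖indicatorConstLp 2 (measurableSet_ball (x := x) (ε := r))
            (measure_ball_lt_top (μ := (volume : Measure (Rd d)))).ne (1 : ℝ)‖ = √m.toReal := by
          rw [norm_indicatorConstLp (by norm_num) (by norm_num), norm_one, one_mul,
            measureReal_def, Measure.addHaar_ball_center, Real.sqrt_eq_rpow]
          norm_num
          rfl
        rw [hn]
        exact mul_le_mul_of_nonneg_left (hM n) (Real.sqrt_nonneg _)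
      · rw [lintegral_const]
        exact ENNReal.mul_ne_top (by simp) (by simpa using measure_ball_lt_top.ne)
      · refine Eventually.of_forall fun x => ?_
        have h1 : Tendsto (fun n => a n x) atTop (𝓝 0) := by
          refine (hw (indicatorConstLp 2 (measurableSet_ball (x := x) (ε := r))
            (measure_ball_lt_top (μ := (volume : Measure (Rd d)))).ne (1 : ℝ))).congr fun n => ?_
          simp only [ha]
          rw [integral_translate_ball_eq_inner, real_inner_comm]
        have h2 := ENNReal.Tendsto.pow (n := 2) h1.enorm
        simpa using! h2
    rw [lintegral_zero] at hlim
    have hpos : (0 : ℝ≥0∞) < m ^ 2 * ENNReal.ofReal r := by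
      refine ENNReal.mul_pos (pow_ne_zero 2 hm0) ?_
      simpa using hr
    have hlim2 : Tendsto (fun n => 2 * ∫⁻ x in Metric.ball (0 : Rd d) R, ‖a n x‖ₑ ^ 2) atTop
        (𝓝 0) := by
      have := ENNReal.Tendsto.const_mul (a := 2) hlim (Or.inr (by simp))
      simpa using this
    filter_upwards [hlim2.eventually (ge_mem_nhds hpos)] with n hn
    have hmw : Measurable (w n) := (Lp.stronglyMeasurable (w n)).measurable
    have hDm : Measurable fun x => ∫⁻ y in B, ‖w n (x + y) - w n x‖ₑ ^ 2 :=
      Measurable.lintegral_prod_right' (f := fun z : Rd d × Rd d =>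
          ‖w n (z.1 + z.2) - w n z.1‖ₑ ^ 2) (by fun_prop)
    have hm2 : m ^ 2 ≠ 0 := pow_ne_zero 2 hm0
    have hm2t : m ^ 2 ≠ ⊤ := ENNReal.pow_ne_top hmt
    rw [← ENNReal.mul_le_mul_iff_right hm2 hm2t]
    calc m ^ 2 * ∫⁻ x in Metric.ball (0 : Rd d) R, ‖w n x‖ₑ ^ 2
        = ∫⁻ x in Metric.ball (0 : Rd d) R, m ^ 2 * ‖w n x‖ₑ ^ 2 := by
          rw [lintegral_const_mul _ (by fun_prop)]
      _ ≤ ∫⁻ x in Metric.ball (0 : Rd d) R,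
          (2 * (m * ∫⁻ y in B, ‖w n (x + y) - w n x‖ₑ ^ 2) + 2 * ‖a n x‖ₑ ^ 2) :=
          lintegral_mono fun x => enorm_sq_le_average (w n) r x
      _ = 2 * (m * ∫⁻ x in Metric.ball (0 : Rd d) R, ∫⁻ y in B, ‖w n (x + y) - w n x‖ₑ ^ 2)
          + 2 * ∫⁻ x in Metric.ball (0 : Rd d) R, ‖a n x‖ₑ ^ 2 := by
          have := hameas n
          rw [lintegral_add_left (by fun_prop), lintegral_const_mul _ (by fun_prop),
            lintegral_const_mul _ hDm, lintegral_const_mul _ (by fun_prop)]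
      _ ≤ 2 * (m * (m * ENNReal.ofReal ((r * K) ^ 2))) + m ^ 2 * ENNReal.ofReal r := by
          gcongr
          refine (setLIntegral_le_lintegral _ _).trans
            (((h n).lintegral_lintegral_ball_sub_le r).trans ?_)
          gcongr
          exact hK n
      _ = m ^ 2 * ENNReal.ofReal (2 * (r * K) ^ 2 + r) := by
          rw [ENNReal.ofReal_add (by positivity) hr.le, ENNReal.ofReal_mul (by norm_num)]
          simp only [ENNReal.ofReal_ofNat]
          ring
  rw [ENNReal.tendsto_nhds_zero]
  intro ε hε
  have hr : Tendsto (fun r : ℝ => ENNReal.ofReal (2 * (r * K) ^ 2 + r)) (𝓝[>] 0) (𝓝 0) := by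
    have hc : Continuous fun r : ℝ => ENNReal.ofReal (2 * (r * K) ^ 2 + r) :=
      ENNReal.continuous_ofReal.comp (by fun_prop)
    have := hc.tendsto 0
    simp only [zero_mul, ne_eq, OfNat.ofNat_ne_zero, not_false_eq_true, zero_pow, mul_zero,
      add_zero, ENNReal.ofReal_zero] at this
    exact this.mono_left nhdsWithin_le_nhds
  obtain ⟨r, hr1, hr2⟩ := ((hr.eventually (ge_mem_nhds hε)).and self_mem_nhdsWithin).exists
  filter_upwards [key r hr2] with n hn
  exact hn.trans hr1

/-! ### Trapping potentials and global compactness -/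

theorem IsTrap.nonneg {V : Rd d → ℝ} (hV : IsTrap V) (x : Rd d) : 0 ≤ V x :=
  hV.inf_eq_zero.1 (mem_range_self x)

theorem IsTrap.continuous {V : Rd d → ℝ} (hV : IsTrap V) : Continuous V := by
  obtain ⟨α, hα, -, H⟩ := hV.holder
  refine continuous_iff_continuousAt.2 fun x => ?_
  obtain ⟨C, hC⟩ := H (‖x‖ + 1)
  refine (hC.continuousOn hα).continuousAt (Metric.closedBall_mem_nhds_of_mem ?_)
  simp

theorem tendsto_lintegral_compl_ball (U : L2 d) :
    Tendsto (fun n : ℕ => ∫⁻ x in (Metric.ball (0 : Rd d) n)ᶜ, ‖U x‖ₑ ^ 2) atTop (𝓝 0) := by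
  have hmU : Measurable U := (Lp.stronglyMeasurable U).measurable
  have h : Tendsto (fun n : ℕ => ∫⁻ x, (Metric.ball (0 : Rd d) n)ᶜ.indicator
      (fun x => ‖U x‖ₑ ^ 2) x) atTop (𝓝 (∫⁻ _ : Rd d, 0)) := by
    refine tendsto_lintegral_of_dominated_convergence (fun x => ‖U x‖ₑ ^ 2)
      (fun n => (hmU.enorm.pow_const 2).indicator measurableSet_ball.compl)
      (fun n => Eventually.of_forall fun x => indicator_le_self _ _ _) ?_ ?_
    · rw [lintegral_enorm_sq]; exact ENNReal.ofReal_ne_top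
    · refine Eventually.of_forall fun x => tendsto_const_nhds.congr' ?_
      obtain ⟨N, hN⟩ := exists_nat_gt ‖x‖
      filter_upwards [eventually_ge_atTop N] with n hn
      rw [indicator_of_notMem]
      have : ‖x‖ < n := hN.trans_le (by exact_mod_cast hn)
      simpa using this
  rw [lintegral_zero] at h
  refine h.congr fun n => ?_
  rw [lintegral_indicator measurableSet_ball.compl]

/-- Compactness of the embedding of the energy space into `L²`: the local compactness is the one
of `H¹`, and a confining potential prevents mass from escaping to infinity. -/
theorem tendsto_of_tendsto_inner {V : Rd d → ℝ} (hV : IsTrap V) {u : ℕ → L2 d} {g : ℕ → L2Vec d}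
    {U : L2 d} {G : L2Vec d} (h : ∀ n, HasWeakGradient (u n) (g n)) (hU : HasWeakGradient U G)
    {M K A : ℝ} (hM : ∀ n, ‖u n‖ ≤ M) (hK : ∀ n, ‖g n‖ ≤ K)
    (hA : ∀ n, ∫⁻ x, ENNReal.ofReal (V x * |u n x| ^ 2) ≤ ENNReal.ofReal A)
    (hu : ∀ y, Tendsto (fun n => (inner ℝ (u n) y : ℝ)) atTop (𝓝 (inner ℝ U y))) :
    Tendsto u atTop (𝓝 U) := by
  have hloc := fun R => tendsto_lintegral_ball_of_tendsto_inner
    (fun n => (h n).sub hU) (M := M + ‖U‖) (K := K + ‖G‖)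
    (fun n => (norm_sub_le _ _).trans (by linarith [hM n]))
    (fun n => (norm_sub_le _ _).trans (by linarith [hK n]))
    (fun y => by
      have := (hu y).sub_const (inner ℝ U y)
      rw [sub_self] at this
      refine this.congr fun n => ?_
      rw [inner_sub_left]) R
  have key : ∀ δ : ℝ, 0 < δ → ∀ᶠ n in atTop, ‖u n - U‖ ^ 2 ≤ 5 * δ := by
    intro δ hδ
    set T : ℝ := (|A| + 1) / δ with hT
    have hT0 : 0 < T := by positivity
    have hδ' : (0 : ℝ≥0∞) < ENNReal.ofReal δ := by simpa using hδ
    obtain ⟨t, htc, ht⟩ := mem_cocompact.1 (hV.tendsto_infinity.eventually_ge_atTop T)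
    obtain ⟨R₀, hR₀⟩ := htc.isBounded.subset_ball (0 : Rd d)
    obtain ⟨N, hN1, hN2⟩ := (((tendsto_lintegral_compl_ball U).eventually
      (ge_mem_nhds hδ')).and (eventually_ge_atTop ⌈R₀⌉₊)).exists
    have hR : R₀ ≤ N := (Nat.le_ceil _).trans (by exact_mod_cast hN2)
    set B := Metric.ball (0 : Rd d) (N : ℝ) with hB
    have hBV : ∀ x ∈ Bᶜ, T ≤ V x := fun x hx =>
      ht fun hxt => hx (Metric.ball_subset_ball hR (hR₀ hxt))
    filter_upwards [(hloc N).eventually (ge_mem_nhds hδ')] with n hn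
    have hmn : Measurable (u n) := (Lp.stronglyMeasurable (u n)).measurable
    have hmU : Measurable U := (Lp.stronglyMeasurable U).measurable
    have htail : ∫⁻ x in Bᶜ, ‖u n x‖ₑ ^ 2 ≤ ENNReal.ofReal δ := by
      have hT' : ENNReal.ofReal T ≠ 0 := by simpa using hT0
      rw [← ENNReal.mul_le_mul_iff_right hT' ENNReal.ofReal_ne_top]
      calc ENNReal.ofReal T * ∫⁻ x in Bᶜ, ‖u n x‖ₑ ^ 2
          = ∫⁻ x in Bᶜ, ENNReal.ofReal T * ‖u n x‖ₑ ^ 2 := by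
            rw [lintegral_const_mul _ (by fun_prop)]
        _ ≤ ∫⁻ x in Bᶜ, ENNReal.ofReal (V x * |u n x| ^ 2) := by
            refine setLIntegral_mono' measurableSet_ball.compl fun x hx => ?_
            rw [Real.enorm_eq_ofReal_abs, ← ENNReal.ofReal_pow (abs_nonneg _),
              ← ENNReal.ofReal_mul hT0.le]
            exact ENNReal.ofReal_le_ofReal (by gcongr; exact hBV x hx)
        _ ≤ ENNReal.ofReal A := (setLIntegral_le_lintegral _ _).trans (hA n)
        _ ≤ ENNReal.ofReal T * ENNReal.ofReal δ := by
            rw [← ENNReal.ofReal_mul hT0.le, hT, div_mul_cancel₀ _ hδ.ne']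
            exact ENNReal.ofReal_le_ofReal (by linarith [le_abs_self A])
    have hcompl : ∫⁻ x in Bᶜ, ‖(u n - U) x‖ₑ ^ 2 ≤ 4 * ENNReal.ofReal δ := by
      calc ∫⁻ x in Bᶜ, ‖(u n - U) x‖ₑ ^ 2
          ≤ ∫⁻ x in Bᶜ, (2 * ‖U x‖ₑ ^ 2 + 2 * ‖u n x‖ₑ ^ 2) := by
            refine lintegral_mono_ae (ae_restrict_of_ae ?_)
            filter_upwards [Lp.coeFn_sub (u n) U] with x hx
            have := enorm_sq_le_two_mul (u n x - U x) (u n x)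
            rw [sub_sub_cancel] at this
            rw [hx]; exact this
        _ = 2 * (∫⁻ x in Bᶜ, ‖U x‖ₑ ^ 2) + 2 * ∫⁻ x in Bᶜ, ‖u n x‖ₑ ^ 2 := by
            rw [lintegral_add_left (by fun_prop), lintegral_const_mul _ (by fun_prop),
              lintegral_const_mul _ (by fun_prop)]
        _ ≤ 2 * ENNReal.ofReal δ + 2 * ENNReal.ofReal δ := by gcongr
        _ = _ := by ring
    rw [← ENNReal.ofReal_le_ofReal_iff (by positivity), ← lintegral_enorm_sq,
      ← lintegral_add_compl _ (measurableSet_ball : MeasurableSet B)]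
    calc _ ≤ ENNReal.ofReal δ + 4 * ENNReal.ofReal δ := add_le_add hn hcompl
      _ = _ := by
        rw [ENNReal.ofReal_mul (by norm_num)]
        simp only [ENNReal.ofReal_ofNat]
        ring
  rw [Metric.tendsto_nhds]
  intro ε hε
  filter_upwards [key (ε ^ 2 / 10) (by positivity)] with n hn
  rw [dist_eq_norm]
  refine lt_of_pow_lt_pow_left₀ 2 hε.le ?_
  nlinarith [pow_pos hε 2]

/-! ### The power nonlinearity on `H¹` -/

theorem HasWeakGradient.integrable_rpow (hd : 1 ≤ d) {p : ℝ} (hp : 1 < p)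
    (hp' : p < 1 + 4 / (d : ℝ)) {u : L2 d} {g : L2Vec d} (h : HasWeakGradient u g) :
    Integrable (fun x => |u x| ^ (p + 1)) := by
  obtain ⟨C, -, H⟩ := exists_lintegral_rpow_le hd hp hp' ‖u‖ one_pos
  have hmu : Measurable u := (Lp.stronglyMeasurable u).measurable
  refine ⟨(by fun_prop : Measurable fun x => |u x| ^ (p + 1)).aestronglyMeasurable, ?_⟩
  rw [hasFiniteIntegral_iff_ofReal (Eventually.of_forall fun x => by positivity)]
  exact (H u g h le_rfl).trans_lt ENNReal.ofReal_lt_top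

theorem exists_integral_rpow_le (hd : 1 ≤ d) {p : ℝ} (hp : 1 < p)
    (hp' : p < 1 + 4 / (d : ℝ)) (M : ℝ) {ε : ℝ} (hε : 0 < ε) :
    ∃ C : ℝ, 0 < C ∧ ∀ (u : L2 d) (g : L2Vec d), HasWeakGradient u g → ‖u‖ ≤ M →
      ∫ x, |u x| ^ (p + 1) ≤ C * ‖u‖ ^ 2 + ε * ‖g‖ ^ 2 := by
  obtain ⟨C, hC, H⟩ := exists_lintegral_rpow_le hd hp hp' M hε
  refine ⟨C, hC, fun u g h hu => ?_⟩
  have h1 := H u g h hu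
  rwa [← ofReal_integral_eq_lintegral_ofReal (h.integrable_rpow hd hp hp')
    (Eventually.of_forall fun x => by positivity), ENNReal.ofReal_le_ofReal_iff (by positivity)]
    at h1

theorem HasWeakGradient.memLp_rpow (hd : 1 ≤ d) {p : ℝ} (hp : 1 < p)
    (hp' : p < 1 + 4 / (d : ℝ)) {u : L2 d} {g : L2Vec d} (h : HasWeakGradient u g) :
    MemLp u (ENNReal.ofReal (p + 1)) volume := by
  have hp1 : 0 < p + 1 := by linarith
  rw [← integrable_norm_rpow_iff (Lp.aestronglyMeasurable u) (by simpa using hp1)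
    ENNReal.ofReal_ne_top, ENNReal.toReal_ofReal hp1.le]
  exact h.integrable_rpow hd hp hp'

/-- Strong convergence in `L²` with bounded weak gradients is convergence in `L^(p+1)`. -/
theorem tendsto_integral_rpow (hd : 1 ≤ d) {p : ℝ} (hp : 1 < p)
    (hp' : p < 1 + 4 / (d : ℝ)) {u : ℕ → L2 d} {g : ℕ → L2Vec d} {U : L2 d} {G : L2Vec d}
    (h : ∀ n, HasWeakGradient (u n) (g n)) (hU : HasWeakGradient U G)
    {K : ℝ} (hK : ∀ n, ‖g n‖ ≤ K) (hu : Tendsto u atTop (𝓝 U)) :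
    Tendsto (fun n => ∫ x, |u n x| ^ (p + 1)) atTop (𝓝 (∫ x, |U x| ^ (p + 1))) := by
  have hp1 : 0 < p + 1 := by linarith
  have hw : Tendsto (fun n => ‖u n - U‖) atTop (𝓝 0) := by
    simpa using (hu.sub_const U).norm
  have hdiff : Tendsto (fun n => ∫ x, |(u n - U) x| ^ (p + 1)) atTop (𝓝 0) := by
    rw [Metric.tendsto_nhds]
    intro ε hε
    have hK0 : 0 ≤ K := (norm_nonneg _).trans (hK 0)
    obtain ⟨C, hC, H⟩ := exists_integral_rpow_le hd hp hp' 1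
      (ε := ε / (2 * ((K + ‖G‖) ^ 2 + 1))) (by positivity)
    have h1 : Tendsto (fun n => C * ‖u n - U‖ ^ 2) atTop (𝓝 0) := by
      simpa using (hw.pow 2).const_mul C
    filter_upwards [hw.eventually (gt_mem_nhds one_pos),
      h1.eventually (gt_mem_nhds (half_pos hε))] with n hn1 hn2
    have h2 := H _ _ ((h n).sub hU) hn1.le
    have h3 : ‖g n - G‖ ^ 2 ≤ (K + ‖G‖) ^ 2 :=
      pow_le_pow_left₀ (norm_nonneg _) ((norm_sub_le _ _).trans (by linarith [hK n])) 2
    have h4 : ε / (2 * ((K + ‖G‖) ^ 2 + 1)) * ‖g n - G‖ ^ 2 ≤ ε / 2 := by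
      rw [div_mul_eq_mul_div, div_le_div_iff₀ (by positivity) (by norm_num)]
      nlinarith
    have h5 : 0 ≤ ∫ x, |(u n - U) x| ^ (p + 1) := integral_nonneg fun x => by positivity
    rw [Real.dist_eq, sub_zero, abs_of_nonneg h5]
    linarith
  have hfact : Fact (1 ≤ ENNReal.ofReal (p + 1)) :=
    ⟨by rw [ENNReal.one_le_ofReal]; linarith⟩
  have hnorm : ∀ {v : L2 d} (hv : MemLp v (ENNReal.ofReal (p + 1)) volume),
      ‖hv.toLp‖ = (∫ x, |v x| ^ (p + 1)) ^ (p + 1)⁻¹ := by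
    intro v hv
    rw [Lp.norm_toLp, hv.eLpNorm_eq_integral_rpow_norm (by simpa using hp1) ENNReal.ofReal_ne_top,
      ENNReal.toReal_ofReal (by positivity), ENNReal.toReal_ofReal hp1.le]
    rfl
  have hmem := fun n => (h n).memLp_rpow hd hp hp'
  have hmemU := hU.memLp_rpow hd hp hp'
  have hLp : Tendsto (fun n => (hmem n).toLp) atTop (𝓝 hmemU.toLp) := by
    rw [tendsto_iff_norm_sub_tendsto_zero]
    have h1 := hdiff.rpow_const (p := (p + 1)⁻¹) (Or.inr (by positivity))
    rw [Real.zero_rpow (by positivity)] at h1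
    refine h1.congr fun n => ?_
    rw [← hnorm (((h n).sub hU).memLp_rpow hd hp hp'), ← MemLp.toLp_sub]
    congr 1
    exact MemLp.toLp_congr _ _ (Lp.coeFn_sub _ _)
  have h2 := hLp.norm.rpow_const (p := p + 1) (Or.inr hp1.le)
  have hback : ∀ {v : L2 d} (hv : MemLp v (ENNReal.ofReal (p + 1)) volume),
      ‖hv.toLp‖ ^ (p + 1) = ∫ x, |v x| ^ (p + 1) := by
    intro v hv
    rw [hnorm hv, ← Real.rpow_mul (integral_nonneg fun x => by positivity),
      inv_mul_cancel₀ hp1.ne', Real.rpow_one]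
  simpa only [hback] using h2

/-! ### The energy space -/

theorem smul_mem_energySpace {V : Rd d → ℝ} {u : L2 d} (hu : u ∈ energySpace V) (c : ℝ) :
    c • u ∈ energySpace V := by
  refine ⟨⟨_, hu.1.hasWeakGradient.smul c⟩, (hu.2.const_mul (c ^ 2)).congr ?_⟩
  filter_upwards [Lp.coeFn_smul c u] with x hx
  rw [hx, Pi.smul_apply, smul_eq_mul, abs_mul, mul_pow, sq_abs c]; ring

theorem add_mem_energySpace {V : Rd d → ℝ} (hV : IsTrap V) {u v : L2 d} (hu : u ∈ energySpace V)
    (hv : v ∈ energySpace V) : u + v ∈ energySpace V := by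
  refine ⟨⟨_, hu.1.hasWeakGradient.add hv.1.hasWeakGradient⟩, ?_⟩
  have hm : Measurable (u + v : L2 d) := (Lp.stronglyMeasurable (u + v)).measurable
  have hVm := hV.continuous.measurable
  refine ((hu.2.const_mul 2).add (hv.2.const_mul 2)).mono'
    (by fun_prop : Measurable _).aestronglyMeasurable ?_
  filter_upwards [Lp.coeFn_add u v] with x hx
  have h0 := hV.nonneg x
  rw [hx, Pi.add_apply, Real.norm_of_nonneg (by positivity), Pi.add_apply]
  simp only [sq_abs]
  have : (u x + v x) ^ 2 ≤ 2 * u x ^ 2 + 2 * v x ^ 2 := by nlinarith [sq_nonneg (u x - v x)]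
  nlinarith

theorem norm_sq_eq_integral_abs (u : L2 d) : ‖u‖ ^ 2 = ∫ x, |u x| ^ 2 := by
  simpa only [Real.norm_eq_abs] using norm_sq_eq_integral u

theorem energy_eq {V : Rd d → ℝ} (p ρ : ℝ) {u : L2 d} {g : L2Vec d} (h : HasWeakGradient u g) :
    energy V p ρ u = 1 / 2 * ‖g‖ ^ 2 + 1 / 2 * (∫ x, V x * |u x| ^ 2)
      - ρ ^ (p - 1) / (p + 1) * ∫ x, |u x| ^ (p + 1) := by
  rw [energy, h.weakGradient_eq, norm_sq_eq_integral]

theorem norm_eq_one_of_mem_unitMass {V : Rd d → ℝ} {u : L2 d} (hu : u ∈ unitMass V) :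
    ‖u‖ = 1 := by
  have h := hu.2
  rw [← norm_sq_eq_integral_abs] at h
  exact (pow_eq_one_iff_of_nonneg (norm_nonneg u) two_ne_zero).1 h

theorem normalize_mem_unitMass {V : Rd d → ℝ} {u : L2 d} (hu : u ∈ energySpace V) (h0 : u ≠ 0) :
    ‖u‖⁻¹ • u ∈ unitMass V := by
  refine ⟨smul_mem_energySpace hu _, ?_⟩
  rw [← norm_sq_eq_integral_abs, norm_smul, norm_inv, norm_norm,
    inv_mul_cancel₀ (norm_ne_zero_iff.2 h0), one_pow]

theorem hasWeakGradient_of_contDiff {f : Rd d → ℝ} (hf : ContDiff ℝ ∞ f) (hc : HasCompactSupport f)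
    {u : L2 d} {g : L2Vec d} (hu : u =ᵐ[volume] f) (hg : g =ᵐ[volume] gradient f) :
    HasWeakGradient u g := by
  intro φ hφ hcφ
  refine ext_inner_left ℝ fun y => ?_
  rw [inner_neg_right, ← integral_inner (integrable_smul_gradient u hφ hcφ),
    ← integral_inner (integrable_test_smul g hφ hcφ)]
  have e1 : ∫ x, inner ℝ y (u x • gradient φ x) = ∫ x, f x * fderiv ℝ φ x y := by
    refine integral_congr_ae ?_
    filter_upwards [hu] with x hx
    rw [hx, inner_smul_right, real_inner_comm, gradient, InnerProductSpace.toDual_symm_apply]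
  have e2 : ∫ x, inner ℝ y (φ x • g x) = ∫ x, fderiv ℝ f x y * φ x := by
    refine integral_congr_ae ?_
    filter_upwards [hg] with x hx
    rw [hx, inner_smul_right, real_inner_comm, gradient, InnerProductSpace.toDual_symm_apply,
      mul_comm]
  have hdf : Continuous fun x => fderiv ℝ f x y :=
    (hf.continuous_fderiv (by simp)).clm_apply continuous_const
  have hdφ : Continuous fun x => fderiv ℝ φ x y :=
    (hφ.continuous_fderiv (by simp)).clm_apply continuous_const
  rw [e1, e2]
  refine integral_mul_fderiv_eq_neg_fderiv_mul_of_integrable ?_ ?_ ?_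
    (fun x _ => hf.differentiable (by simp) x) (fun x _ => hφ.differentiable (by simp) x)
  · exact (hdf.mul hφ.continuous).integrable_of_hasCompactSupport hcφ.mul_left
  · exact (hf.continuous.mul hdφ).integrable_of_hasCompactSupport hc.mul_right
  · exact (hf.continuous.mul hφ.continuous).integrable_of_hasCompactSupport hc.mul_right

theorem unitMass_nonempty {V : Rd d → ℝ} (hV : IsTrap V) : (unitMass V).Nonempty := by
  let f : ContDiffBump (0 : Rd d) := default
  have hf : ContDiff ℝ ∞ f := f.contDiff
  have hc : HasCompactSupport f := f.hasCompactSupport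
  have hu : MemLp f 2 (volume : Measure (Rd d)) := hf.continuous.memLp_of_hasCompactSupport hc
  have hg : MemLp (gradient f) 2 (volume : Measure (Rd d)) :=
    (continuous_gradient_of_contDiff hf).memLp_of_hasCompactSupport (hasCompactSupport_gradient hc)
  refine ⟨_, normalize_mem_unitMass (u := hu.toLp) ⟨⟨hg.toLp, ?_⟩, ?_⟩ ?_⟩
  · exact hasWeakGradient_of_contDiff hf hc hu.coeFn_toLp hg.coeFn_toLp
  · have hi : Integrable (fun x => V x * (f x * f x)) :=
      (hV.continuous.mul (hf.continuous.mul hf.continuous)).integrable_of_hasCompactSupport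
        (hc.mul_left).mul_left
    refine hi.congr ?_
    filter_upwards [hu.coeFn_toLp] with x hx
    rw [hx, sq_abs, sq]
  · intro h0
    have h1 : f =ᵐ[volume] (fun _ => (0 : ℝ)) := by
      filter_upwards [hu.coeFn_toLp, Lp.coeFn_zero ℝ 2 (volume : Measure (Rd d))] with x hx hx0
      rw [← hx, h0, hx0]; rfl
    have h2 := (hf.continuous.ae_eq_iff_eq volume continuous_const).1 h1
    have h3 : f 0 = 1 := f.one_of_mem_closedBall (by simpa using f.rIn_pos.le)
    rw [h2] at h3
    exact zero_ne_one h3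

/-! ### Existence of minimizers -/

theorem ofReal_integral_potential {V : Rd d → ℝ} (hV : IsTrap V) {u : L2 d}
    (hu : u ∈ energySpace V) : ∫⁻ x, ENNReal.ofReal (V x * |u x| ^ 2)
      = ENNReal.ofReal (∫ x, V x * |u x| ^ 2) :=
  (ofReal_integral_eq_lintegral_ofReal hu.2
    (Eventually.of_forall fun x => mul_nonneg (hV.nonneg x) (by positivity))).symm

theorem integral_potential_nonneg {V : Rd d → ℝ} (hV : IsTrap V) (u : L2 d) :
    0 ≤ ∫ x, V x * |u x| ^ 2 :=
  integral_nonneg fun x => mul_nonneg (hV.nonneg x) (by positivity)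

/-- Coercivity of the energy on the unit sphere. -/
theorem exists_energy_ge (hd : 1 ≤ d) {p : ℝ} (hp : 1 < p) (hp' : p < 1 + 4 / (d : ℝ))
    (V : Rd d → ℝ) {ρ : ℝ} (hρ : 0 < ρ) :
    ∃ C : ℝ, ∀ u ∈ unitMass V,
      1 / 4 * ‖weakGradient u‖ ^ 2 + 1 / 2 * (∫ x, V x * |u x| ^ 2) - C ≤ energy V p ρ u := by
  set κ := ρ ^ (p - 1) / (p + 1) with hκ
  have hκ0 : 0 < κ := by have : 0 < p + 1 := by linarith
                         positivity
  obtain ⟨C, -, H⟩ := exists_integral_rpow_le hd hp hp' 1 (ε := 1 / (4 * κ)) (by positivity)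
  refine ⟨κ * C, fun u hu => ?_⟩
  have hn := norm_eq_one_of_mem_unitMass hu
  have h1 := H u _ hu.1.1.hasWeakGradient hn.le
  rw [energy_eq p ρ hu.1.1.hasWeakGradient, ← hκ]
  have h2 := mul_le_mul_of_nonneg_left h1 hκ0.le
  have h3 : κ * (C * ‖u‖ ^ 2 + 1 / (4 * κ) * ‖weakGradient u‖ ^ 2)
      = κ * C + 1 / 4 * ‖weakGradient u‖ ^ 2 := by rw [hn]; field_simp
  linarith

theorem minimizers_nonempty (hd : 1 ≤ d) {p : ℝ} (hp : 1 < p) (hp' : p < 1 + 4 / (d : ℝ))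
    {V : Rd d → ℝ} (hV : IsTrap V) {ρ : ℝ} (hρ : 0 < ρ) : (minimizers V p ρ).Nonempty := by
  obtain ⟨C, hC⟩ := exists_energy_ge hd hp hp' V hρ
  set κ := ρ ^ (p - 1) / (p + 1) with hκ
  set S := energy V p ρ '' unitMass V with hS
  have hSne : S.Nonempty := (unitMass_nonempty hV).image _
  have hSb : BddBelow S := by
    refine ⟨-C, ?_⟩
    rintro _ ⟨u, hu, rfl⟩
    have := hC u hu
    have h1 := integral_potential_nonneg hV u
    have h2 := sq_nonneg ‖weakGradient u‖
    linarith
  set e := sInf S with he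
  have hseq : ∀ n : ℕ, ∃ u ∈ unitMass V, energy V p ρ u < e + 1 / ((n : ℝ) + 1) := by
    intro n
    obtain ⟨_, ⟨u, hu, rfl⟩, hlt⟩ := exists_lt_of_csInf_lt hSne
      (lt_add_of_pos_right e (by positivity : (0 : ℝ) < 1 / ((n : ℝ) + 1)))
    exact ⟨u, hu, hlt⟩
  choose u hu hue using hseq
  have hgrad := fun n => (hu n).1.1.hasWeakGradient
  have hnorm := fun n => norm_eq_one_of_mem_unitMass (hu n)
  have hE1 : ∀ n, energy V p ρ (u n) ≤ e + 1 := by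
    intro n
    have : 1 / ((n : ℝ) + 1) ≤ 1 := by
      rw [div_le_one (by positivity)]; linarith [(Nat.cast_nonneg n : (0 : ℝ) ≤ n)]
    linarith [hue n]
  have hK : ∀ n, ‖weakGradient (u n)‖ ≤ √(4 * (e + 1 + C)) := by
    intro n
    refine Real.le_sqrt_of_sq_le ?_
    linarith [hC _ (hu n), integral_potential_nonneg hV (u n), hE1 n]
  have hA : ∀ n, ∫⁻ x, ENNReal.ofReal (V x * |u n x| ^ 2) ≤ ENNReal.ofReal (2 * (e + 1 + C)) := by
    intro n
    rw [ofReal_integral_potential hV (hu n).1]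
    refine ENNReal.ofReal_le_ofReal ?_
    linarith [hC _ (hu n), sq_nonneg ‖weakGradient (u n)‖, hE1 n]
  have : Fact ((2 : ℝ≥0∞) ≠ ⊤) := ⟨by norm_num⟩
  -- extract weakly convergent subsequences of the functions and of their gradients
  obtain ⟨U, ns₁, hns₁, hU⟩ := exists_subseq_tendsto_inner u 1 fun n => (hnorm n).le
  obtain ⟨G, ns₂, hns₂, hG⟩ := exists_subseq_tendsto_inner (fun n => weakGradient (u (ns₁ n))) _
    fun n => hK (ns₁ n)
  have hU₂ : ∀ y, Tendsto (fun n => (inner ℝ (u (ns₁ (ns₂ n))) y : ℝ)) atTop (𝓝 (inner ℝ U y)) :=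
    fun y => (hU y).comp hns₂.tendsto_atTop
  have hUG : HasWeakGradient U G :=
    hasWeakGradient_of_tendsto_inner (fun n => hgrad (ns₁ (ns₂ n))) hU₂ hG
  have hstrong : Tendsto (fun n => u (ns₁ (ns₂ n))) atTop (𝓝 U) :=
    tendsto_of_tendsto_inner hV (fun n => hgrad _) hUG (fun n => (hnorm _).le) (fun n => hK _)
      (fun n => hA _) hU₂
  obtain ⟨ns₃, hns₃, hae⟩ := (tendstoInMeasure_of_tendsto_Lp hstrong).exists_seq_tendsto_ae
  set ns : ℕ → ℕ := fun n => ns₁ (ns₂ (ns₃ n)) with hns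
  have hns_mono : StrictMono ns := hns₁.comp (hns₂.comp hns₃)
  have hB := tendsto_integral_rpow hd hp hp' (fun n => hgrad (ns n)) hUG (fun n => hK (ns n))
    (hstrong.comp hns₃.tendsto_atTop)
  have hinner := (hG G).comp hns₃.tendsto_atTop
  have hee : Tendsto (fun n => energy V p ρ (u (ns n))) atTop (𝓝 e) := by
    have hle : ∀ n, e ≤ energy V p ρ (u n) := fun n => csInf_le hSb ⟨_, hu n, rfl⟩
    have ht : Tendsto (fun n : ℕ => e + 1 / ((n : ℝ) + 1)) atTop (𝓝 e) := by
      simpa using tendsto_one_div_add_atTop_nhds_zero_nat.const_add e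
    exact (tendsto_of_tendsto_of_tendsto_of_le_of_le tendsto_const_nhds ht hle
      fun n => (hue n).le).comp hns_mono.tendsto_atTop
  set a : ℕ → ℝ := fun n => 2 * energy V p ρ (u (ns n)) + 2 * κ * (∫ x, |u (ns n) x| ^ (p + 1))
    - 2 * inner ℝ (weakGradient (u (ns n))) G + ‖G‖ ^ 2 with ha
  set a' : ℝ := 2 * e + 2 * κ * (∫ x, |U x| ^ (p + 1)) - ‖G‖ ^ 2 with ha'
  have hlim : Tendsto a atTop (𝓝 a') := by
    have h1 := (((hee.const_mul 2).add (hB.const_mul (2 * κ))).sub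
      (hinner.const_mul 2)).add_const (‖G‖ ^ 2)
    rw [real_inner_self_eq_norm_sq] at h1
    have h2 : 2 * e + 2 * κ * (∫ x, |U x| ^ (p + 1)) - 2 * ‖G‖ ^ 2 + ‖G‖ ^ 2 = a' := by
      rw [ha']; ring
    rw [h2] at h1
    exact h1
  -- weak lower semicontinuity of the gradient term, in the form `‖g‖² ≥ 2⟪g, G⟫ - ‖G‖²`
  have hPa : ∀ n, ∫ x, V x * |u (ns n) x| ^ 2 ≤ a n := by
    intro n
    have h1 := energy_eq (V := V) p ρ (hgrad (ns n))
    have h2 := norm_sub_sq_real (weakGradient (u (ns n))) G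
    have h3 := sq_nonneg ‖weakGradient (u (ns n)) - G‖
    simp only [ha]
    rw [h1, ← hκ]
    linarith
  have ha'0 : 0 ≤ a' := ge_of_tendsto' hlim fun n => (integral_potential_nonneg hV _).trans (hPa n)
  have hfatou : ∫⁻ x, ENNReal.ofReal (V x * |U x| ^ 2) ≤ ENNReal.ofReal a' := by
    have hVm := hV.continuous.measurable
    have hm : ∀ n, Measurable fun x => ENNReal.ofReal (V x * |u (ns n) x| ^ 2) := by
      intro n
      have := (Lp.stronglyMeasurable (u (ns n))).measurable
      fun_prop
    calc ∫⁻ x, ENNReal.ofReal (V x * |U x| ^ 2)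
        = ∫⁻ x, liminf (fun n => ENNReal.ofReal (V x * |u (ns n) x| ^ 2)) atTop := by
          refine lintegral_congr_ae ?_
          filter_upwards [hae] with x hx
          refine (Tendsto.liminf_eq ?_).symm
          exact ENNReal.tendsto_ofReal ((hx.abs.pow 2).const_mul (V x))
      _ ≤ liminf (fun n => ∫⁻ x, ENNReal.ofReal (V x * |u (ns n) x| ^ 2)) atTop :=
          lintegral_liminf_le hm
      _ ≤ liminf (fun n => ENNReal.ofReal (a n)) atTop := by
          refine liminf_le_liminf (Eventually.of_forall fun n => ?_)
          change ∫⁻ x, ENNReal.ofReal (V x * |u (ns n) x| ^ 2) ≤ ENNReal.ofReal (a n)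
          rw [ofReal_integral_potential hV (hu (ns n)).1]
          exact ENNReal.ofReal_le_ofReal (hPa n)
      _ = ENNReal.ofReal a' := (ENNReal.tendsto_ofReal hlim).liminf_eq
  have hUint : Integrable (fun x => V x * |U x| ^ 2) := by
    have hVm := hV.continuous.measurable
    have hmU := (Lp.stronglyMeasurable U).measurable
    refine ⟨(by fun_prop : Measurable fun x => V x * |U x| ^ 2).aestronglyMeasurable, ?_⟩
    rw [hasFiniteIntegral_iff_ofReal
      (Eventually.of_forall fun x => mul_nonneg (hV.nonneg x) (by positivity))]
    exact hfatou.trans_lt ENNReal.ofReal_lt_top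
  have hUE : U ∈ energySpace V := ⟨⟨G, hUG⟩, hUint⟩
  have hUP : ∫ x, V x * |U x| ^ 2 ≤ a' := by
    rwa [ofReal_integral_potential hV hUE, ENNReal.ofReal_le_ofReal_iff ha'0] at hfatou
  have hU1 : ‖U‖ = 1 := by
    refine tendsto_nhds_unique hstrong.norm ?_
    simp only [hnorm]
    exact tendsto_const_nhds
  refine ⟨U, ⟨hUE, ?_⟩, fun v hv => ?_⟩
  · rw [← norm_sq_eq_integral_abs, hU1, one_pow]
  · refine le_trans ?_ (csInf_le hSb ⟨v, hv, rfl⟩ : e ≤ _)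
    rw [energy_eq p ρ hUG, ← hκ]
    linarith

/-! ### Derivatives of the terms of the energy along lines -/

theorem hasDerivAt_norm_add_smul_sq {H : Type*} [NormedAddCommGroup H] [InnerProductSpace ℝ H]
    (a b : H) : HasDerivAt (fun t : ℝ => ‖a + t • b‖ ^ 2) (2 * inner ℝ a b) 0 := by
  have h := (((hasDerivAt_id (0 : ℝ)).smul_const b).const_add a).norm_sq
  simpa using! h

theorem coeFn_add_smul (u φ : L2 d) (t : ℝ) :
    (u + t • φ : L2 d) =ᵐ[volume] fun x => u x + t * φ x := by
  filter_upwards [Lp.coeFn_add u (t • φ), Lp.coeFn_smul t φ] with x h1 h2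
  rw [h1, Pi.add_apply, h2, Pi.smul_apply, smul_eq_mul]

theorem integrable_potential_mul {V : Rd d → ℝ} (hV : IsTrap V) {u φ : L2 d}
    (hu : u ∈ energySpace V) (hφ : φ ∈ energySpace V) :
    Integrable (fun x => V x * u x * φ x) := by
  have hmu : Measurable u := (Lp.stronglyMeasurable u).measurable
  have hmφ : Measurable φ := (Lp.stronglyMeasurable φ).measurable
  have hVm := hV.continuous.measurable
  refine (hu.2.add hφ.2).mono' (by fun_prop : Measurable _).aestronglyMeasurable ?_
  refine Eventually.of_forall fun x => ?_
  have h0 := hV.nonneg x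
  rw [Pi.add_apply, mul_assoc, norm_mul, Real.norm_of_nonneg h0, ← mul_add, norm_mul,
    Real.norm_eq_abs, Real.norm_eq_abs]
  refine mul_le_mul_of_nonneg_left ?_ h0
  nlinarith [sq_nonneg (|u x| - |φ x|), sq_nonneg (|u x| + |φ x|)]

theorem hasDerivAt_integral_potential {V : Rd d → ℝ} (hV : IsTrap V) {u φ : L2 d}
    (hu : u ∈ energySpace V) (hφ : φ ∈ energySpace V) :
    HasDerivAt (fun t : ℝ => ∫ x, V x * |(u + t • φ) x| ^ 2) (2 * ∫ x, V x * u x * φ x) 0 := by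
  have hi := integrable_potential_mul hV hu hφ
  have h : (fun t : ℝ => ∫ x, V x * |(u + t • φ) x| ^ 2) = fun t : ℝ =>
      (∫ x, V x * |u x| ^ 2) + t * (2 * ∫ x, V x * u x * φ x)
        + t ^ 2 * ∫ x, V x * |φ x| ^ 2 := by
    ext t
    have e : ∫ x, V x * |(u + t • φ) x| ^ 2 = ∫ x, (V x * |u x| ^ 2
        + t * (2 * (V x * u x * φ x)) + t ^ 2 * (V x * |φ x| ^ 2)) := by
      refine integral_congr_ae ?_
      filter_upwards [coeFn_add_smul u φ t] with x hx
      rw [hx]; simp only [sq_abs]; ring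
    have hi1 : Integrable fun x => t * (2 * (V x * u x * φ x)) := (hi.const_mul 2).const_mul t
    have hi2 : Integrable fun x => V x * |u x| ^ 2 + t * (2 * (V x * u x * φ x)) := hu.2.add hi1
    rw [e, integral_add hi2 (hφ.2.const_mul _), integral_add hu.2 hi1, integral_const_mul, integral_const_mul,
      integral_const_mul]
  rw [h]
  have h1 := (((hasDerivAt_id (0 : ℝ)).mul_const (2 * ∫ x, V x * u x * φ x)).const_add
    (∫ x, V x * |u x| ^ 2)).add (((hasDerivAt_id (0 : ℝ)).pow 2).mul_const
      (∫ x, V x * |φ x| ^ 2))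
  simpa using! h1

theorem hasDerivAt_integral_rpow (hd : 1 ≤ d) {p : ℝ} (hp : 1 < p)
    (hp' : p < 1 + 4 / (d : ℝ)) {u φ : L2 d} (hu : MemH1 u) (hφ : MemH1 φ) :
    HasDerivAt (fun t : ℝ => ∫ x, |(u + t • φ) x| ^ (p + 1))
      ((p + 1) * ∫ x, |u x| ^ (p - 1) * u x * φ x) 0 := by
  have hp1 : 0 < p + 1 := by linarith
  have hmu : Measurable u := (Lp.stronglyMeasurable u).measurable
  have hmφ : Measurable φ := (Lp.stronglyMeasurable φ).measurable
  have hLu := hu.hasWeakGradient.memLp_rpow hd hp hp'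
  have hLφ := hφ.hasWeakGradient.memLp_rpow hd hp hp'
  have hbd : Integrable (fun x => (p + 1) * (|u x| + |φ x|) ^ (p + 1)) := by
    have h1 := (hLu.norm.add hLφ.norm).integrable_norm_rpow (by simpa using hp1)
      ENNReal.ofReal_ne_top
    rw [ENNReal.toReal_ofReal hp1.le] at h1
    refine (h1.const_mul (p + 1)).congr (Eventually.of_forall fun x => ?_)
    simp only [Pi.add_apply, Real.norm_eq_abs]
    rw [abs_of_nonneg (by positivity)]
  have h := hasDerivAt_integral_of_dominated_loc_of_deriv_le
    (μ := (volume : Measure (Rd d))) (s := Metric.ball (0 : ℝ) 1) (x₀ := (0 : ℝ))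
    (F := fun t x => |u x + t * φ x| ^ (p + 1))
    (F' := fun t x => (p + 1) * |u x + t * φ x| ^ (p + 1 - 2) * (u x + t * φ x) * φ x)
    (bound := fun x => (p + 1) * (|u x| + |φ x|) ^ (p + 1))
    (Metric.ball_mem_nhds _ one_pos)
    (Eventually.of_forall fun t =>
      (by fun_prop : Measurable fun x => |u x + t * φ x| ^ (p + 1)).aestronglyMeasurable)
    (by simpa using hu.hasWeakGradient.integrable_rpow hd hp hp')
    (by fun_prop : Measurable fun x => (p + 1) * |u x + 0 * φ x| ^ (p + 1 - 2) *
      (u x + 0 * φ x) * φ x).aestronglyMeasurable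
    (Eventually.of_forall fun x t ht => ?_) hbd (Eventually.of_forall fun x t _ => ?_)
  · have h2 := h.2
    have e1 : (fun t : ℝ => ∫ x, |(u + t • φ) x| ^ (p + 1))
        = fun t : ℝ => ∫ x, |u x + t * φ x| ^ (p + 1) := by
      ext t
      refine integral_congr_ae ?_
      filter_upwards [coeFn_add_smul u φ t] with x hx
      rw [hx]
    rw [e1, ← integral_const_mul]
    refine h2.congr_deriv ?_
    congr 1; ext x
    have : p + 1 - 2 = p - 1 := by ring
    rw [this, zero_mul, add_zero]; ring
  · have ht' : |t| ≤ 1 := by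
      rw [mem_ball_zero_iff, Real.norm_eq_abs] at ht; exact ht.le
    set z := u x + t * φ x with hz
    have hzle : |z| ≤ |u x| + |φ x| := by
      refine (abs_add_le _ _).trans ?_
      rw [abs_mul]
      have := mul_le_mul_of_nonneg_right ht' (abs_nonneg (φ x))
      linarith
    have hφle : |φ x| ≤ |u x| + |φ x| := by linarith [abs_nonneg (u x)]
    have hs0 : 0 ≤ |u x| + |φ x| := by positivity
    rw [norm_mul, norm_mul, norm_mul, Real.norm_of_nonneg hp1.le,
      Real.norm_of_nonneg (Real.rpow_nonneg (abs_nonneg z) _), Real.norm_eq_abs, Real.norm_eq_abs]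
    calc (p + 1) * |z| ^ (p + 1 - 2) * |z| * |φ x|
        ≤ (p + 1) * (|u x| + |φ x|) ^ (p + 1 - 2) * (|u x| + |φ x|) * (|u x| + |φ x|) := by
          have : 0 ≤ p + 1 - 2 := by linarith
          gcongr
      _ = (p + 1) * (|u x| + |φ x|) ^ (p + 1) := by
          have e : (|u x| + |φ x|) ^ (p + 1)
              = (|u x| + |φ x|) ^ (p + 1 - 2) * (|u x| + |φ x|) ^ (2 : ℝ) := by
            rw [← Real.rpow_add' hs0 (by linarith)]; congr 1; ring
          rw [e, Real.rpow_two]; ring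
  · have h1 : HasDerivAt (fun t => u x + t * φ x) (φ x) t := by
      simpa using! ((hasDerivAt_id t).mul_const (φ x)).const_add (u x)
    exact (hasDerivAt_abs_rpow (u x + t * φ x) (by linarith : 1 < p + 1)).comp t h1

theorem action_eq_energy_sub {V : Rd d → ℝ} (p μ ρ : ℝ) {u : L2 d} (hu : u ∈ energySpace V) :
    action V p μ ρ u = energy V p ρ u - μ / 2 * ‖u‖ ^ 2 := by
  have hi := integrable_norm_sq u
  have h : ∫ x, (V x - μ) * |u x| ^ 2 = (∫ x, V x * |u x| ^ 2) - μ * ‖u‖ ^ 2 := by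
    rw [norm_sq_eq_integral, ← integral_const_mul, ← integral_sub hu.2 (hi.const_mul μ)]
    congr 1; ext x
    rw [Real.norm_eq_abs]; ring
  rw [action, energy, h]; ring

theorem integral_mul_eq_inner {u φ : L2 d} : ∫ x, u x * φ x = inner ℝ u φ := by
  rw [L2.inner_def]; congr 1; ext x; simp [mul_comm]

theorem hasDerivAt_energy (hd : 1 ≤ d) {p : ℝ} (hp : 1 < p) (hp' : p < 1 + 4 / (d : ℝ))
    {V : Rd d → ℝ} (hV : IsTrap V) (ρ : ℝ) {u φ : L2 d} (hu : u ∈ energySpace V)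
    (hφ : φ ∈ energySpace V) :
    HasDerivAt (fun t : ℝ => energy V p ρ (u + t • φ))
      ((∫ x, inner ℝ (weakGradient u x) (weakGradient φ x)) + (∫ x, V x * u x * φ x)
        - ρ ^ (p - 1) * ∫ x, |u x| ^ (p - 1) * u x * φ x) 0 := by
  have hp1 : p + 1 ≠ 0 := by linarith
  have h1 := hasDerivAt_norm_add_smul_sq (weakGradient u) (weakGradient φ)
  have h2 := hasDerivAt_integral_potential hV hu hφ
  have h3 := hasDerivAt_integral_rpow hd hp hp' hu.1 hφ.1
  have h4 := ((h1.const_mul (1 / 2)).add (h2.const_mul (1 / 2))).sub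
    (h3.const_mul (ρ ^ (p - 1) / (p + 1)))
  have e : (fun t : ℝ => energy V p ρ (u + t • φ)) = fun t : ℝ =>
      1 / 2 * ‖weakGradient u + t • weakGradient φ‖ ^ 2
        + 1 / 2 * (∫ x, V x * |(u + t • φ) x| ^ 2)
        - ρ ^ (p - 1) / (p + 1) * ∫ x, |(u + t • φ) x| ^ (p + 1) := by
    ext t
    rw [energy_eq p ρ (hu.1.hasWeakGradient.add (hφ.1.hasWeakGradient.smul t))]
  rw [e, ← L2.inner_def]
  refine HasDerivAt.congr_deriv h4 ?_
  field_simp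

theorem hasDerivAt_action (hd : 1 ≤ d) {p : ℝ} (hp : 1 < p) (hp' : p < 1 + 4 / (d : ℝ))
    {V : Rd d → ℝ} (hV : IsTrap V) (μ ρ : ℝ) {u φ : L2 d} (hu : u ∈ energySpace V)
    (hφ : φ ∈ energySpace V) :
    HasDerivAt (fun t : ℝ => action V p μ ρ (u + t • φ))
      ((∫ x, inner ℝ (weakGradient u x) (weakGradient φ x)) + (∫ x, V x * u x * φ x)
        - ρ ^ (p - 1) * (∫ x, |u x| ^ (p - 1) * u x * φ x) - μ * ∫ x, u x * φ x) 0 := by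
  have h := (hasDerivAt_energy hd hp hp' hV ρ hu hφ).sub
    ((hasDerivAt_norm_add_smul_sq u φ).const_mul (μ / 2))
  have e : (fun t : ℝ => action V p μ ρ (u + t • φ)) = fun t : ℝ =>
      energy V p ρ (u + t • φ) - μ / 2 * ‖u + t • φ‖ ^ 2 := by
    ext t
    rw [action_eq_energy_sub p μ ρ (add_mem_energySpace hV hu (smul_mem_energySpace hφ t))]
  rw [e, integral_mul_eq_inner]
  refine HasDerivAt.congr_deriv h ?_
  ring

theorem mem_nontrivialSolutions_iff (hd : 1 ≤ d) {p : ℝ} (hp : 1 < p) (hp' : p < 1 + 4 / (d : ℝ))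
    {V : Rd d → ℝ} (hV : IsTrap V) (μ ρ : ℝ) {u : L2 d} :
    u ∈ nontrivialSolutions V p μ ρ ↔ u ≠ 0 ∧ IsWeakSolution V p μ ρ u := by
  constructor
  · rintro ⟨hu, h0, H⟩
    refine ⟨h0, hu, fun φ hφ => ?_⟩
    have := (hasDerivAt_action hd hp hp' hV μ ρ hu hφ).unique (H φ hφ)
    linarith
  · rintro ⟨h0, hu, H⟩
    refine ⟨hu, h0, fun φ hφ => ?_⟩
    have := hasDerivAt_action hd hp hp' hV μ ρ hu hφ
    refine this.congr_deriv ?_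
    have := H φ hφ
    linarith

/-! ### Scaling and the Nehari identity -/

theorem integral_rpow_smul {p : ℝ} (u : L2 d) (c : ℝ) :
    ∫ x, |(c • u) x| ^ (p + 1) = |c| ^ (p + 1) * ∫ x, |u x| ^ (p + 1) := by
  rw [← integral_const_mul]
  refine integral_congr_ae ?_
  filter_upwards [Lp.coeFn_smul c u] with x hx
  rw [hx, Pi.smul_apply, smul_eq_mul, abs_mul, Real.mul_rpow (abs_nonneg _) (abs_nonneg _)]

theorem energy_smul {V : Rd d → ℝ} (p ρ c : ℝ) {u : L2 d} (hu : MemH1 u) :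
    energy V p ρ (c • u) =
      1 / 2 * c ^ 2 * (‖weakGradient u‖ ^ 2 + ∫ x, V x * |u x| ^ 2)
        - ρ ^ (p - 1) / (p + 1) * |c| ^ (p + 1) * ∫ x, |u x| ^ (p + 1) := by
  have h : ∫ x, V x * |(c • u) x| ^ 2 = c ^ 2 * ∫ x, V x * |u x| ^ 2 := by
    rw [← integral_const_mul]
    refine integral_congr_ae ?_
    filter_upwards [Lp.coeFn_smul c u] with x hx
    rw [hx, Pi.smul_apply, smul_eq_mul, abs_mul, mul_pow, sq_abs c]; ring
  rw [energy_eq p ρ (hu.hasWeakGradient.smul c), integral_rpow_smul, h, norm_smul, mul_pow,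
    Real.norm_eq_abs, sq_abs]
  ring

theorem integral_rpow_pos (hd : 1 ≤ d) {p : ℝ} (hp : 1 < p) (hp' : p < 1 + 4 / (d : ℝ))
    {u : L2 d} (hu : MemH1 u) (h0 : u ≠ 0) : 0 < ∫ x, |u x| ^ (p + 1) := by
  have hn : 0 ≤ ∫ x, |u x| ^ (p + 1) := integral_nonneg fun x => by positivity
  refine hn.lt_of_ne fun h => h0 ?_
  have h1 := (integral_eq_zero_iff_of_nonneg (fun x => by positivity)
    (hu.hasWeakGradient.integrable_rpow hd hp hp')).1 h.symm
  refine Lp.ext ?_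
  filter_upwards [h1, Lp.coeFn_zero ℝ 2 (volume : Measure (Rd d))] with x hx hx0
  rw [hx0, Pi.zero_apply]
  have h2 := (Real.rpow_eq_zero (abs_nonneg (u x)) (by linarith : p + 1 ≠ 0)).1 hx
  exact abs_eq_zero.1 h2

/-- The Nehari identity: a weak solution tested against itself. -/
theorem IsWeakSolution.nehari {p μ ρ : ℝ} (hp : 1 < p) {V : Rd d → ℝ} {u : L2 d}
    (hu : IsWeakSolution V p μ ρ u) :
    ‖weakGradient u‖ ^ 2 + (∫ x, V x * |u x| ^ 2)
      = μ * ‖u‖ ^ 2 + ρ ^ (p - 1) * ∫ x, |u x| ^ (p + 1) := by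
  have h := hu.2 u hu.1
  have e1 : ∫ x, V x * u x * u x = ∫ x, V x * |u x| ^ 2 := by
    congr 1; ext x; rw [sq_abs]; ring
  have e2 : ∫ x, |u x| ^ (p - 1) * u x * u x = ∫ x, |u x| ^ (p + 1) := by
    congr 1; ext x
    have e : |u x| ^ (p + 1) = |u x| ^ (p - 1) * |u x| ^ (2 : ℝ) := by
      rw [← Real.rpow_add' (abs_nonneg _) (by linarith)]; congr 1; ring
    rw [e, Real.rpow_two, sq_abs]; ring
  rwa [e1, e2, integral_mul_eq_inner, real_inner_self_eq_norm_sq, ← L2.inner_def,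
    real_inner_self_eq_norm_sq] at h

theorem sq_div_two_sub_rpow_lt {p t : ℝ} (hp : 1 < p) (ht : 0 < t) (ht1 : t ≠ 1) :
    1 / 2 * t ^ 2 - t ^ (p + 1) / (p + 1) < 1 / 2 - 1 / (p + 1) := by
  have hp1 : 0 < p + 1 := by linarith
  have hs : t ^ 2 - 1 ≠ 0 := by
    intro h
    exact ht1 ((pow_eq_one_iff_of_nonneg ht.le two_ne_zero).1 (by linarith))
  have h := one_add_mul_self_lt_rpow_one_add (s := t ^ 2 - 1) (by nlinarith) hs
    (p := (p + 1) / 2) (by linarith)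
  have e : (1 + (t ^ 2 - 1)) ^ ((p + 1) / 2) = t ^ (p + 1) := by
    rw [add_sub_cancel, ← Real.rpow_two, ← Real.rpow_mul ht.le]; congr 1; ring
  rw [e] at h
  have h2 : (1 + (p + 1) / 2 * (t ^ 2 - 1)) / (p + 1) < t ^ (p + 1) / (p + 1) :=
    div_lt_div_of_pos_right h hp1
  have e2 : (1 + (p + 1) / 2 * (t ^ 2 - 1)) / (p + 1) = 1 / (p + 1) + 1 / 2 * (t ^ 2 - 1) := by
    field_simp
  linarith

/-- Along the ray through a nontrivial solution, the action has a strict maximum at the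
solution. -/
theorem action_smul_lt (hd : 1 ≤ d) {p : ℝ} (hp : 1 < p) (hp' : p < 1 + 4 / (d : ℝ))
    {V : Rd d → ℝ} {μ ρ : ℝ} (hρ : 0 < ρ) {v : L2 d} (h0 : v ≠ 0)
    (hv : IsWeakSolution V p μ ρ v) {t : ℝ} (ht : 0 < t) (ht1 : t ≠ 1) :
    action V p μ ρ (t • v) < action V p μ ρ v := by
  have hp1 : 0 < p + 1 := by linarith
  have hN := hv.nehari hp
  have hB := integral_rpow_pos hd hp hp' hv.1.1 h0
  set B := ∫ x, |v x| ^ (p + 1)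
  set Q := ‖weakGradient v‖ ^ 2 + ∫ x, V x * |v x| ^ 2
  have hray : ∀ c : ℝ, 0 < c → action V p μ ρ (c • v)
      = ρ ^ (p - 1) * B * (1 / 2 * c ^ 2 - c ^ (p + 1) / (p + 1)) := by
    intro c hc
    rw [action_eq_energy_sub p μ ρ (smul_mem_energySpace hv.1 c), energy_smul p ρ c hv.1.1,
      norm_smul, mul_pow, Real.norm_eq_abs, sq_abs, abs_of_pos hc]
    change 1 / 2 * c ^ 2 * Q - ρ ^ (p - 1) / (p + 1) * c ^ (p + 1) * B
      - μ / 2 * (c ^ 2 * ‖v‖ ^ 2) = _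
    rw [hN]; ring
  have h1 := hray 1 one_pos
  rw [one_smul, Real.one_rpow, one_pow, mul_one] at h1
  rw [h1, hray t ht]
  exact mul_lt_mul_of_pos_left (sq_div_two_sub_rpow_lt hp ht ht1) (by positivity)

/-! ### The Lagrange multiplier of a minimizer -/

/-- A minimizer solves the equation with the Lagrange multiplier given by the Nehari identity. -/
theorem isWeakSolution_of_mem_minimizers (hd : 1 ≤ d) {p : ℝ} (hp : 1 < p)
    (hp' : p < 1 + 4 / (d : ℝ)) {V : Rd d → ℝ} (hV : IsTrap V) {ρ : ℝ} {u : L2 d}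
    (hu : u ∈ minimizers V p ρ) :
    IsWeakSolution V p
      (2 * energy V p ρ u - (p - 1) * (ρ ^ (p - 1) / (p + 1)) * ∫ x, |u x| ^ (p + 1)) ρ u := by
  have hp1 : p + 1 ≠ 0 := by linarith
  refine ⟨hu.1.1, fun φ hφ => ?_⟩
  have hE := hu.1.1
  have hn := norm_eq_one_of_mem_unitMass hu.1
  set κ := ρ ^ (p - 1) / (p + 1) with hκ
  set e := energy V p ρ u with he
  set w : ℝ → L2 d := fun t => u + t • φ with hw
  have hwE : ∀ t, w t ∈ energySpace V := fun t =>
    add_mem_energySpace hV hE (smul_mem_energySpace hφ t)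
  have hw0 : w 0 = u := by simp [hw]
  -- `f t ≥ 0` is minimality of `u` against the normalization of `w t`, multiplied by `‖w t‖²`
  set f : ℝ → ℝ := fun t => energy V p ρ (w t) + κ * (∫ x, |w t x| ^ (p + 1))
    - κ * (∫ x, |w t x| ^ (p + 1)) * (‖w t‖ ^ 2) ^ (-((p - 1) / 2)) - e * ‖w t‖ ^ 2 with hf
  have hf0 : f 0 = 0 := by
    simp only [hf, hw0, hn, one_pow, Real.one_rpow, mul_one]; ring
  have hfnonneg : ∀ t, w t ≠ 0 → 0 ≤ f t := by
    intro t ht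
    have hpos : 0 < ‖w t‖ := norm_pos_iff.2 ht
    have h1 := hu.2 _ (normalize_mem_unitMass (hwE t) ht)
    rw [energy_smul p ρ _ (hwE t).1, abs_of_pos (inv_pos.2 hpos), ← hκ, ← he] at h1
    have h2 := mul_le_mul_of_nonneg_right h1 (sq_nonneg ‖w t‖)
    have e1 : (‖w t‖⁻¹) ^ (p + 1) * ‖w t‖ ^ 2 = (‖w t‖ ^ 2) ^ (-((p - 1) / 2)) := by
      rw [Real.inv_rpow hpos.le, ← Real.rpow_neg hpos.le, ← Real.rpow_two,
        ← Real.rpow_add hpos, ← Real.rpow_mul hpos.le]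
      congr 1; ring
    have e2 : (‖w t‖⁻¹) ^ 2 * ‖w t‖ ^ 2 = 1 := by
      rw [← mul_pow, inv_mul_cancel₀ hpos.ne', one_pow]
    have e3 := energy_eq (V := V) p ρ (hwE t).1.hasWeakGradient
    rw [← hκ] at e3
    simp only [hf]
    rw [← e1, e3]
    set Q := ‖weakGradient (w t)‖ ^ 2 + ∫ x, V x * |w t x| ^ 2
    set B := ∫ x, |w t x| ^ (p + 1)
    have e4 : (1 / 2 * (‖w t‖⁻¹) ^ 2 * Q - κ * (‖w t‖⁻¹) ^ (p + 1) * B) * ‖w t‖ ^ 2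
        = 1 / 2 * Q * ((‖w t‖⁻¹) ^ 2 * ‖w t‖ ^ 2)
          - κ * B * ((‖w t‖⁻¹) ^ (p + 1) * ‖w t‖ ^ 2) := by ring
    rw [e4, e2] at h2
    have e5 : 1 / 2 * Q = 1 / 2 * ‖weakGradient (w t)‖ ^ 2
        + 1 / 2 * ∫ x, V x * |w t x| ^ 2 := by simp only [Q]; ring
    linarith
  have hmin : IsLocalMin f 0 := by
    have hcont : ContinuousAt w 0 := by fun_prop
    have hne : ∀ᶠ t in 𝓝 (0 : ℝ), w t ≠ 0 := by
      refine hcont.eventually_ne ?_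
      rw [hw0, ← norm_pos_iff, hn]; exact one_pos
    filter_upwards [hne] with t ht
    rw [hf0]; exact hfnonneg t ht
  have hdE := hasDerivAt_energy hd hp hp' hV ρ hE hφ
  have hdB := (hasDerivAt_integral_rpow hd hp hp' hE.1 hφ.1).const_mul κ
  have hdN := hasDerivAt_norm_add_smul_sq u φ
  have hdP := hdN.rpow_const (p := -((p - 1) / 2)) (Or.inl (by simp [hn]))
  have hdf := (((hdE.add hdB).sub (hdB.mul hdP)).sub (hdN.const_mul e))
  have h0 := hmin.hasDerivAt_eq_zero hdf
  simp only [zero_smul, add_zero, hn, one_pow, Real.one_rpow, mul_one] at h0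
  rw [integral_mul_eq_inner]
  linear_combination h0

/-! ### Ground states and minimizers -/

/-- If all minimizers have the same multiplier `μ`, then the minimizers are the ground states:
on the ray through a solution the action is largest at the solution, and on the unit sphere the
action and the energy differ by a constant. -/
theorem groundStates_eq_minimizers (hd : 1 ≤ d) {p : ℝ} (hp : 1 < p) (hp' : p < 1 + 4 / (d : ℝ))
    {V : Rd d → ℝ} (hV : IsTrap V) {μ ρ : ℝ} (hρ : 0 < ρ) (hne : (minimizers V p ρ).Nonempty)
    (hμ : ∀ u ∈ minimizers V p ρ, IsWeakSolution V p μ ρ u) :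
    groundStates V p μ ρ = minimizers V p ρ := by
  have hsol := fun u => mem_nontrivialSolutions_iff hd hp hp' hV μ ρ (u := u)
  have hsphere : ∀ u ∈ unitMass V, action V p μ ρ u = energy V p ρ u - μ / 2 := by
    intro u hu
    rw [action_eq_energy_sub p μ ρ hu.1, norm_eq_one_of_mem_unitMass hu]; ring
  have hnz : ∀ u ∈ unitMass V, u ≠ 0 := by
    intro u hu
    rw [← norm_pos_iff, norm_eq_one_of_mem_unitMass hu]; exact one_pos
  have hMS : ∀ u ∈ minimizers V p ρ, u ∈ nontrivialSolutions V p μ ρ := fun u hu =>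
    (hsol u).2 ⟨hnz u hu.1, hμ u hu⟩
  have hle : ∀ u ∈ minimizers V p ρ, ∀ v, v ≠ 0 → v ∈ energySpace V →
      action V p μ ρ u ≤ action V p μ ρ (‖v‖⁻¹ • v) := by
    intro u hu v hv0 hv
    have h1 := normalize_mem_unitMass hv hv0
    rw [hsphere u hu.1, hsphere _ h1]
    linarith [hu.2 _ h1]
  ext v
  constructor
  · rintro ⟨hv, hmin⟩
    obtain ⟨u, hu⟩ := hne
    obtain ⟨hv0, hvw⟩ := (hsol v).1 hv
    have h1 : ‖v‖ = 1 := by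
      by_contra hn
      have h2 := action_smul_lt hd hp hp' hρ hv0 hvw (inv_pos.2 (norm_pos_iff.2 hv0))
        (fun h => hn (inv_eq_one.1 h))
      linarith [hle u hu v hv0 hvw.1, hmin u (hMS u hu)]
    have hvU : v ∈ unitMass V := ⟨hvw.1, by rw [← norm_sq_eq_integral_abs, h1, one_pow]⟩
    refine ⟨hvU, fun z hz => ?_⟩
    have h2 := hmin u (hMS u hu)
    rw [hsphere v hvU, hsphere u hu.1] at h2
    linarith [hu.2 z hz]
  · intro hv
    refine ⟨hMS v hv, fun z hz => ?_⟩
    obtain ⟨hz0, hzw⟩ := (hsol z).1 hz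
    refine (hle v hv z hz0 hzw.1).trans ?_
    rcases eq_or_ne ‖z‖⁻¹ 1 with h1 | h1
    · rw [h1, one_smul]
    · exact (action_smul_lt hd hp hp' hρ hz0 hzw (inv_pos.2 (norm_pos_iff.2 hz0)) h1).le

/-! ### Uniqueness of the multiplier for almost every mass -/

/-- The power integral of the minimizers increases with the mass: add the two minimality
inequalities. -/
theorem integral_rpow_le_of_lt {p : ℝ} (hp : 1 < p) {V : Rd d → ℝ} {ρ₁ ρ₂ : ℝ} (h₁ : 0 < ρ₁)
    (h : ρ₁ < ρ₂) {u v : L2 d} (hu : u ∈ minimizers V p ρ₁) (hv : v ∈ minimizers V p ρ₂) :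
    ∫ x, |u x| ^ (p + 1) ≤ ∫ x, |v x| ^ (p + 1) := by
  have hp1 : 0 < p + 1 := by linarith
  have hκ : ρ₁ ^ (p - 1) / (p + 1) < ρ₂ ^ (p - 1) / (p + 1) :=
    div_lt_div_of_pos_right (Real.rpow_lt_rpow h₁.le h (by linarith)) hp1
  have e1 := hu.2 v hv.1
  have e2 := hv.2 u hu.1
  simp only [energy] at e1 e2
  by_contra! hlt
  nlinarith

/-- For all but countably many masses, the power integral takes a single value on the set of
minimizers. -/
theorem ae_integral_rpow_eq (hd : 1 ≤ d) {p : ℝ} (hp : 1 < p) (hp' : p < 1 + 4 / (d : ℝ))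
    {V : Rd d → ℝ} (hV : IsTrap V) : ∀ᵐ ρ : ℝ, 0 < ρ → ∀ u ∈ minimizers V p ρ,
      ∀ v ∈ minimizers V p ρ, ∫ x, |u x| ^ (p + 1) = ∫ x, |v x| ^ (p + 1) := by
  classical
  have hne : ∀ ρ : ℝ, ∃ u : L2 d, 0 < ρ → u ∈ minimizers V p ρ := by
    intro ρ
    by_cases hρ : 0 < ρ
    · obtain ⟨u, hu⟩ := minimizers_nonempty hd hp hp' hV hρ
      exact ⟨u, fun _ => hu⟩
    · exact ⟨0, fun h => absurd h hρ⟩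
  choose U hU using hne
  set b : ℝ → ℝ := fun ρ => ∫ x, |U ρ x| ^ (p + 1) with hb
  have hmono : MonotoneOn b (Ioi 0) := by
    intro ρ₁ h₁ ρ₂ h₂ h
    rcases h.eq_or_lt with rfl | hlt
    · exact le_rfl
    · exact integral_rpow_le_of_lt hp h₁ hlt (hU ρ₁ h₁) (hU ρ₂ h₂)
  have hnull := hmono.countable_not_continuousWithinAt.measure_zero volume
  filter_upwards [compl_mem_ae_iff.2 hnull] with ρ hρ hρ0
  have hcw : ContinuousWithinAt b (Ioi 0) ρ := by
    by_contra hcon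
    exact hρ ⟨hρ0, hcon⟩
  have hc : ContinuousAt b ρ := hcw.continuousAt (Ioi_mem_nhds hρ0)
  have key : ∀ u ∈ minimizers V p ρ, ∫ x, |u x| ^ (p + 1) = b ρ := by
    intro u hu
    refine le_antisymm ?_ ?_
    · refine ge_of_tendsto (hc.tendsto.mono_left (nhdsWithin_le_nhds (s := Ioi ρ))) ?_
      filter_upwards [self_mem_nhdsWithin] with r hr
      exact integral_rpow_le_of_lt hp hρ0 hr hu (hU r (hρ0.trans hr))
    · refine le_of_tendsto (hc.tendsto.mono_left (nhdsWithin_le_nhds (s := Iio ρ))) ?_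
      filter_upwards [self_mem_nhdsWithin,
        mem_nhdsWithin_of_mem_nhds (Ioi_mem_nhds hρ0)] with r hr hr0
      exact integral_rpow_le_of_lt hp hr0 hr (hU r hr0) hu
  intro u hu v hv
  rw [key u hu, key v hv]

end NLS

theorem theorem1p1 (d : ℕ) (hd : 1 ≤ d) (p : ℝ) (hp : 1 < p) (hp' : p < 1 + 4 / (d : ℝ))
    (V : NLS.Rd d → ℝ) (hV : NLS.IsTrap V) :
    ∀ᵐ ρ : ℝ, 0 < ρ →
      (NLS.minimizers V p ρ).Nonempty ∧
      ∃ μ : ℝ,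
        (∀ u ∈ NLS.minimizers V p ρ, NLS.IsWeakSolution V p μ ρ u) ∧
        NLS.groundStates V p μ ρ = NLS.minimizers V p ρ := by
  filter_upwards [NLS.ae_integral_rpow_eq hd hp hp' hV] with ρ huniq hρ
  have hne := NLS.minimizers_nonempty hd hp hp' hV hρ
  obtain ⟨u₀, hu₀⟩ := hne
  have hμ : ∀ u ∈ NLS.minimizers V p ρ, NLS.IsWeakSolution V p (2 * NLS.energy V p ρ u₀
      - (p - 1) * (ρ ^ (p - 1) / (p + 1)) * ∫ x, |u₀ x| ^ (p + 1)) ρ u := by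
    intro u hu
    have h := NLS.isWeakSolution_of_mem_minimizers hd hp hp' hV hu
    rwa [huniq hρ u hu u₀ hu₀, le_antisymm (hu.2 u₀ hu₀.1) (hu₀.2 u hu.1)] at h
  exact ⟨⟨u₀, hu₀⟩, _, hμ, NLS.groundStates_eq_minimizers hd hp hp' hV hρ ⟨u₀, hu₀⟩ hμ⟩
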